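/- Let $n\ge 1$. Let $F$ be a formally real Pythagorean field (so $-1$ is not a sum of squares in $F$, and every sum of squares in $F$ is a square), and let $\tilde F$ be an expansion of $F$ in a language $\mathcal L$ extending the language of unital rings $\{+,\cdot,-,0,1\}$. Suppose $\tilde F$ has quantifier elimination in $\mathcal L$. For an $\mathcal L$-structure $\tilde K$ that expands a field $K$, let $M_n(\tilde K)$ be the $\mathcal L$-structure that expands the matrix ring $M_n(K)$ as follows, where the center $C=K\cdot I_n$ of $M_n(K)$ is identified with $K$: a relation symbol of $\mathcal L$ that is not in the language of rings is interpreted as a relation on $C$, as given by $\tilde K$; a function symbol of arity $m\ge 0$ of $\mathcal L$ that is not in the language of rings is interpreted on $C^m$ as given by $\tilde K$, and takes the value $0$ outside $C^m$. Let $\mathcal L(\mathrm{tr},\mathrm{inv})$ be the extension of $\mathcal L$ by two new unary function symbols, and write $\mathcal M_n(\tilde K)=(M_n(\tilde K),\ X\mapsto \mathrm{tr}(X)I_n,\ X\mapsto X^t)$. Then the following are equivalent: 1. $\mathcal M_n(\tilde F)$ has quantifier elimination in $\mathcal L(\mathrm{tr},\mathrm{inv})$. 2. ($F$ has the Specht property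 for the transpose.) There is some $D\in\mathbb N$ (depending on $n$) such that for all $d$ and any two $d$-tuples $X=(X_1,\dots,X_d)$, $Y=(Y_1,\dots,Y_d)$ of matrices in $M_n(F)$ with $\mathrm{tr}(w(X,X^t))=\mathrm{tr}(w(Y,Y^t))$ for all words $w$ of length $\le D$ in the letters $x_1,\dots,x_d,x_1^t,\dots,x_d^t$, there is some $O\in M_n(F)$ with $OO^t=I_n$ and $O^tX_iO=Y_i$ for all $i$. 3. Whenever $\tilde K$ is an $\mathcal L$-structure elementarily equivalent to $\tilde F$, $\mathcal U$ is a substructure of $\mathcal M_n(\tilde K)$ and $\psi:\mathcal U\to\mathcal M_n(\tilde K)$ is an embedding, there are an elementary extension $\tilde\Omega\succ\tilde K$ and an embedding $\mathcal M_n(\tilde K)\to\mathcal M_n(\tilde\Omega)$ that extends $\psi$, where $\psi$ is composed with the inclusion $M_n(K)\subseteq M_n(\Omega)$. -/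

import Mathlib

open FirstOrder FirstOrder.Language FirstOrder.Ring
open scoped Matrix

universe u v w x

/-- A field is Pythagorean if every sum of squares is a square. -/
def IsPythagorean (F : Type u) [Field F] : Prop :=
  ∀ a : F, IsSumSq a → IsSquare a

/-- A structure has quantifier elimination if every formula is equivalent in it (equivalently:
modulo its complete theory) to a quantifier-free formula in the same variables. -/
def HasQE (L : FirstOrder.Language.{v, w}) (M : Type u) [L.Structure M] : Prop :=
  ∀ (k : ℕ) (φ : L.Formula (Fin k)), ∃ ψ : L.Formula (Fin k),
    BoundedFormula.IsQF ψ ∧ ∀ a : Fin k → M, φ.Realize a ↔ ψ.Realize a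

/-- Two unary function symbols, for the trace and for the transposition. -/
inductive TrInvFunc : ℕ → Type
  | tr : TrInvFunc 1
  | inv : TrInvFunc 1

/-- The language consisting of the two unary function symbols `tr` and `inv`. -/
def trInvLang : FirstOrder.Language.{0, 0} where
  Functions := TrInvFunc
  Relations := fun _ => Empty

/-- The language of unital rings together with the new symbols in `L`. -/
abbrev fieldLang (L : FirstOrder.Language.{v, w}) : FirstOrder.Language.{v, w} := Language.ring.sum L

/-- The extension of `fieldLang L` by the two unary function symbols `tr` and `inv`. -/
def matLang (L : FirstOrder.Language.{v, w}) : FirstOrder.Language.{v, w} := (fieldLang L).sum trInvLang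

/-- The interpretation in `M_n(K)` of the new symbols `L`, given their interpretation in `K`.
The center of `M_n(K)` is the set of scalar matrices; it is identified with `K` through
`a ↦ a • 1`. Relations hold only between central elements, where they are as given in `K`;
functions (in particular constants) are as given in `K` on central elements, and are `0` as soon
as one of the arguments is not central. -/
@[reducible]
noncomputable def newSymbolsStructure (L : FirstOrder.Language.{v, w}) (n : ℕ) (K : Type u) [Field K]
    [L.Structure K] : L.Structure (Matrix (Fin n) (Fin n) K) where
  funMap := fun {m} f X =>
    open Classical in
    if h : ∃ a : Fin m → K, ∀ i, X i = Matrix.scalar (Fin n) (a i) then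
      Matrix.scalar (Fin n) (Structure.funMap f h.choose)
    else 0
  RelMap := fun {m} r X =>
    ∃ a : Fin m → K, (∀ i, X i = Matrix.scalar (Fin n) (a i)) ∧ Structure.RelMap r a

/-- `tr` is the trace, as a scalar matrix, and `inv` is the transposition. -/
@[reducible]
def trInvStructure (n : ℕ) (K : Type u) [Field K] :
    trInvLang.Structure (Matrix (Fin n) (Fin n) K) where
  funMap := fun {_} f =>
    match f with
    | TrInvFunc.tr => fun X => Matrix.scalar (Fin n) (Matrix.trace (X 0))
    | TrInvFunc.inv => fun X => (X 0)ᵀ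
  RelMap := fun r _ => Empty.elim r

/-- The structure `(M_n(K), tr, transpose)` for the expansion of the field `K` given by an
interpretation of the new symbols `L`. -/
noncomputable instance matStructure (L : FirstOrder.Language.{v, w}) (n : ℕ) (K : Type u) [Field K]
    [L.Structure K] : (matLang L).Structure (Matrix (Fin n) (Fin n) K) :=
  @Language.sumStructure (fieldLang L) trInvLang _
    (@Language.sumStructure Language.ring L _
      (compatibleRingOfRing (Matrix (Fin n) (Fin n) K)).toStructure
      (newSymbolsStructure L n K))
    (trInvStructure n K)

/-- The value at `X` of a word in the letters `x_i` (coded `(i, false)`) and `x_i^t`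
(coded `(i, true)`). -/
def wordEval {F : Type u} [Field F] {n d : ℕ} (X : Fin d → Matrix (Fin n) (Fin n) F)
    (w : List (Fin d × Bool)) : Matrix (Fin n) (Fin n) F :=
  (w.map fun p => if p.2 then (X p.1)ᵀ else X p.1).prod

/-- The Specht property for the transpose, for matrices of size `n`. -/
def SpechtProperty (F : Type u) [Field F] (n : ℕ) : Prop :=
  ∃ D : ℕ, ∀ (d : ℕ) (X Y : Fin d → Matrix (Fin n) (Fin n) F),
    (∀ w : List (Fin d × Bool), w.length ≤ D →
      (wordEval X w).trace = (wordEval Y w).trace) →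
    ∃ O : Matrix (Fin n) (Fin n) F, O * Oᵀ = 1 ∧ ∀ i, Oᵀ * X i * O = Y i

/-- For every `K` elementarily equivalent to `F`, every embedding `ψ` of a substructure `U` of
`(M_n(K), tr, transpose)` into `(M_n(K), tr, transpose)` extends to an embedding of
`(M_n(K), tr, transpose)` into `(M_n(Ω), tr, transpose)` for some elementary extension `Ω` of `K`
(given as the target of an elementary embedding `j`, which `M_n(K) → M_n(Ω)` applies entrywise).
The universe of `K` is an arbitrary one above that of `F`; the universe of `Ω` leaves room for the
cardinality of the language. -/
def EmbeddingsExtend (L : FirstOrder.Language.{v, w}) (F : Type u) [Field F] [CompatibleRing F]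
    [L.Structure F] (n : ℕ) : Prop :=
  ∀ (K : Type (max u x)) [Field K] [CompatibleRing K] [L.Structure K],
    F ≅[fieldLang L] K →
    ∀ (U : (matLang L).Substructure (Matrix (Fin n) (Fin n) K))
      (ψ : U ↪[matLang L] Matrix (Fin n) (Fin n) K),
    ∃ (Ω : Type (max u v w x)) (_ : Field Ω) (_ : CompatibleRing Ω) (_ : L.Structure Ω)
      (j : K ↪ₑ[fieldLang L] Ω)
      (g : Matrix (Fin n) (Fin n) K ↪[matLang L] Matrix (Fin n) (Fin n) Ω),
      ∀ y : U, g (y : Matrix (Fin n) (Fin n) K) = (ψ y).map j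

/-! Over a formally real Pythagorean field, `tr(A Aᵗ)` is a sum of squares and vanishes only for `A
= 0`, and every nonzero vector can be normalized to length one. By the first fact, traces decide
equality: if `X` and `Y` have the same traces of words up to a certain length, then `p(X) ↦ p(Y)` is
well defined and injective on combinations of words up to half that length, and it respects
centrality and the new symbols. Hence the truth of a given quantifier-free formula depends on
finitely many traces, once scalar parameters are fixed (`exists_realize_iff_of_tracesAgree`). By the
second fact, a system that behaves like the first column of matrix units comes from an orthogonal
matrix (`exists_orthogonal_of_column`).

1 ⇒ 2: "there are matrix units in which the tuple has the entries `c`" is a formula; made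
quantifier-free, it passes from `X` to any `Y` with the same traces up to some length, with `c` the
entries of `X`. 2 ⇒ 1: a formula in matrices is a formula in their entries. By Specht, it holds at
`X` iff the traces of `X` are those of some realization; quantifier elimination in `F` makes this
condition on the traces quantifier-free. 2 ⇒ 3: on the center an embedding is partial elementary, so
it extends to an elementary map into some `Ω`. After this correction of the scalars, the
substructure and its image have equal traces in `Ω`, and Specht supplies the conjugating matrix. 3 ⇒
2: an ultraproduct of counterexamples gives tuples with the same traces of all words, hence an
embedding that fixes the scalars. Its extension is conjugation over `Ω`; elementarity and Łoś bring
conjugacy back to a counterexample. Specht transfers to elementarily equivalent fields because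
tuples of length `2n²` suffice, which makes it a sentence for each `D`. -/

/-! ### Formally real Pythagorean fields -/

/-- Sums of two squares are squares, and `-1` is not a square: a first-order axiomatization of
formally real Pythagorean fields. -/
structure IsRealPythagorean (K : Type*) [Field K] : Prop where
  exists_sq_add_sq : ∀ x y : K, ∃ z, x * x + y * y = z * z
  sq_add_one_ne_zero : ∀ x : K, x * x + 1 ≠ 0

theorem IsPythagorean.isRealPythagorean {F : Type u} [Field F] [IsSemireal F]
    (hF : IsPythagorean F) : IsRealPythagorean F where
  exists_sq_add_sq x y :=
    hF _ ((IsSumSq.mul_self x).add (IsSumSq.mul_self y))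
  sq_add_one_ne_zero x h :=
    IsSemireal.one_add_ne_zero (IsSumSq.mul_self x) (by rw [add_comm]; exact h)

namespace IsRealPythagorean

variable {K : Type*} [Field K]

theorem exists_sum_sq (hK : IsRealPythagorean K) {ι : Type*} (s : Finset ι) (f : ι → K) :
    ∃ z, ∑ i ∈ s, f i * f i = z * z := by
  classical
  induction s using Finset.induction_on with
  | empty => exact ⟨0, by simp⟩
  | insert a s ha ih =>
    obtain ⟨z, hz⟩ := ih
    rw [Finset.sum_insert ha, hz]
    exact hK.exists_sq_add_sq _ _

theorem sq_add_sq_eq_zero (hK : IsRealPythagorean K) {x y : K} (h : x * x + y * y = 0) : x = 0 := by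
  by_contra hx
  refine hK.sq_add_one_ne_zero (y / x) ?_
  field_simp
  linear_combination h

theorem sum_sq_eq_zero (hK : IsRealPythagorean K) {ι : Type*} {s : Finset ι} {f : ι → K}
    (h : ∑ i ∈ s, f i * f i = 0) : ∀ i ∈ s, f i = 0 := by
  classical
  intro i hi
  rw [← Finset.add_sum_erase s _ hi] at h
  obtain ⟨z, hz⟩ := hK.exists_sum_sq (s.erase i) f
  rw [hz] at h
  exact hK.sq_add_sq_eq_zero h

/-- Used to recover a scalar matrix from its trace by dividing by `n`. -/
theorem natCast_ne_zero (hK : IsRealPythagorean K) {n : ℕ} (hn : 0 < n) : (n : K) ≠ 0 := by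
  intro h
  have := hK.sum_sq_eq_zero (s := (Finset.univ : Finset (Fin n))) (f := fun _ => 1) (by simpa)
    ⟨0, hn⟩ (Finset.mem_univ _)
  exact one_ne_zero this

variable {n : ℕ}

/-- The trace is the sum of the squares of all entries. This anisotropy is what lets traces detect
equality of matrices. -/
theorem eq_zero_of_trace_mul_transpose (hK : IsRealPythagorean K) {A : Matrix (Fin n) (Fin n) K}
    (h : (A * Aᵀ).trace = 0) : A = 0 := by
  have h' : ∑ p : Fin n × Fin n, A p.1 p.2 * A p.1 p.2 = 0 := by
    rw [Fintype.sum_prod_type]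
    simpa [Matrix.trace, Matrix.mul_apply] using h
  ext i j
  exact hK.sum_sq_eq_zero h' (i, j) (Finset.mem_univ _)

/-- A system `G` that behaves like the first column of a system of matrix units yields an
orthogonal matrix. -/
theorem exists_orthogonal_of_column (hK : IsRealPythagorean K) (i₀ : Fin n)
    (G : Fin n → Matrix (Fin n) (Fin n) K)
    (hG : ∀ i j, (G i)ᵀ * G j = if i = j then G i₀ else 0) (h0 : G i₀ ≠ 0) :
    ∃ O : Matrix (Fin n) (Fin n) K, O * Oᵀ = 1 ∧
      ∀ X Y : Matrix (Fin n) (Fin n) K,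
        (∀ i, Y * G i = ∑ j, X j i • G j) → Oᵀ * Y * O = X := by
  -- `G i₀` is a symmetric idempotent, so it fixes its own columns. For a nonzero column `u`, the
  -- vectors `G i *ᵥ u` are pairwise orthogonal and all have the norm of `u`.
  obtain ⟨k, hk⟩ : ∃ k, (G i₀).col k ≠ 0 := by
    by_contra! h
    apply h0
    ext i j
    exact congrFun (h j) i
  set u : Fin n → K := (G i₀).col k with hu
  have hGG : G i₀ * G i₀ = G i₀ := by
    have h1 : (G i₀)ᵀ = G i₀ := by
      have := hG i₀ i₀
      rw [if_pos rfl] at this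
      rw [← this, Matrix.transpose_mul, Matrix.transpose_transpose]
    have := hG i₀ i₀
    rwa [if_pos rfl, h1] at this
  have hGu : G i₀ *ᵥ u = u := by
    ext i
    have := congrFun (congrFun hGG i) k
    simpa [Matrix.mul_apply, Matrix.mulVec, dotProduct, hu] using this
  have huu : u ⬝ᵥ u ≠ 0 := by
    intro h
    apply hk
    ext i
    exact hK.sum_sq_eq_zero (s := Finset.univ) (f := u) h i (Finset.mem_univ _)
  -- The Pythagorean property: the common norm is a square, so the vectors can be scaled to an
  -- orthonormal basis.
  obtain ⟨c, hc⟩ : ∃ c, u ⬝ᵥ u = c * c := hK.exists_sum_sq Finset.univ u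
  have hc0 : c ≠ 0 := by rintro rfl; simp [hc] at huu
  let P : Matrix (Fin n) (Fin n) K := Matrix.of fun a i => (G i *ᵥ u) a
  have hPP : Pᵀ * P = (c * c) • (1 : Matrix (Fin n) (Fin n) K) := by
    ext i j
    have : (Pᵀ * P) i j = (G i *ᵥ u) ⬝ᵥ (G j *ᵥ u) := rfl
    rw [this, ← Matrix.vecMul_transpose, ← Matrix.dotProduct_mulVec, Matrix.mulVec_mulVec, hG]
    by_cases hij : i = j
    · simp [hij, hGu, hc]
    · simp [hij]
  let O : Matrix (Fin n) (Fin n) K := c⁻¹ • P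
  have hO : Oᵀ * O = 1 := by
    simp only [O, Matrix.transpose_smul, Matrix.smul_mul, Matrix.mul_smul, hPP, smul_smul]
    rw [show c⁻¹ * (c⁻¹ * (c * c)) = 1 by field_simp, one_smul]
  refine ⟨O, mul_eq_one_comm.mp hO, fun X Y h => ?_⟩
  have hYP : Y * P = P * X := by
    ext a i
    have h1 : (Y * P) a i = (Y *ᵥ (G i *ᵥ u)) a := rfl
    rw [h1, Matrix.mulVec_mulVec, h, Matrix.sum_mulVec, Finset.sum_apply, Matrix.mul_apply]
    refine Finset.sum_congr rfl fun j _ => ?_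
    simp [P, Matrix.smul_mulVec, mul_comm]
  have hYO : Y * O = O * X := by
    simp only [O, Matrix.mul_smul, Matrix.smul_mul, hYP]
  rw [Matrix.mul_assoc, hYO, ← Matrix.mul_assoc, hO, Matrix.one_mul]

end IsRealPythagorean

/-- The first column of the standard matrix units. -/
theorem single_column_transpose_mul {K : Type*} [Field K] {n : ℕ} (i₀ i j : Fin n) :
    (Matrix.single i i₀ (1 : K))ᵀ * Matrix.single j i₀ 1 =
      if i = j then Matrix.single i₀ i₀ 1 else 0 := by
  rw [Matrix.transpose_single]
  split_ifs with h
  · subst h; simp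
  · simp [h]

theorem mul_single_column {K : Type*} [Field K] {n : ℕ} (i₀ i : Fin n)
    (X : Matrix (Fin n) (Fin n) K) :
    X * Matrix.single i i₀ 1 = ∑ j, X j i • Matrix.single j i₀ (1 : K) := by
  ext a b
  rw [Matrix.sum_apply]
  simp [Matrix.mul_apply, Matrix.single_apply, ite_and]

/-! ### Spans of words -/

section Words

variable {K : Type*} [Field K] {n d : ℕ}

@[simp]
theorem wordEval_nil (X : Fin d → Matrix (Fin n) (Fin n) K) : wordEval X [] = 1 := rfl

theorem wordEval_append (X : Fin d → Matrix (Fin n) (Fin n) K) (v w : List (Fin d × Bool)) :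
    wordEval X (v ++ w) = wordEval X v * wordEval X w := by
  simp [wordEval]

theorem wordEval_cons (X : Fin d → Matrix (Fin n) (Fin n) K) (p : Fin d × Bool)
    (w : List (Fin d × Bool)) :
    wordEval X (p :: w) = (if p.2 then (X p.1)ᵀ else X p.1) * wordEval X w := by
  simp [wordEval]

/-- The word whose value is the transpose of the value of `w`. -/
def transposeWord (w : List (Fin d × Bool)) : List (Fin d × Bool) :=
  (w.map fun p => (p.1, !p.2)).reverse

theorem wordEval_transposeWord (X : Fin d → Matrix (Fin n) (Fin n) K) (w : List (Fin d × Bool)) :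
    wordEval X (transposeWord w) = (wordEval X w)ᵀ := by
  induction w with
  | nil => simp [transposeWord]
  | cons p w ih =>
    have : transposeWord (p :: w) = transposeWord w ++ [(p.1, !p.2)] := by simp [transposeWord]
    rw [this, wordEval_append, wordEval_cons, ih, wordEval_cons, Matrix.transpose_mul]
    rcases p with ⟨i, _ | _⟩ <;> simp

/-- The tuples `X` and `Y` have the same traces of words of length at most `D`. -/
def TracesAgree (X Y : Fin d → Matrix (Fin n) (Fin n) K) (D : ℕ) : Prop :=
  ∀ w : List (Fin d × Bool), w.length ≤ D → (wordEval X w).trace = (wordEval Y w).trace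

theorem TracesAgree.mono {X Y : Fin d → Matrix (Fin n) (Fin n) K} {D D' : ℕ}
    (h : TracesAgree X Y D) (hD : D' ≤ D) : TracesAgree X Y D' :=
  fun w hw => h w (hw.trans hD)

/-- The span of the pairs of values at `X` and at `Y` of the words of length at most `m`. -/
def wordSpan (X Y : Fin d → Matrix (Fin n) (Fin n) K) (m : ℕ) :
    Submodule K (Matrix (Fin n) (Fin n) K × Matrix (Fin n) (Fin n) K) :=
  Submodule.span K ((fun w => (wordEval X w, wordEval Y w)) '' {w | w.length ≤ m})

variable {X Y : Fin d → Matrix (Fin n) (Fin n) K} {m m' D : ℕ}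

theorem wordSpan_mono (h : m ≤ m') : wordSpan X Y m ≤ wordSpan X Y m' :=
  Submodule.span_mono (Set.image_mono fun _ hw => le_trans hw h)

theorem wordEval_mem_wordSpan (w : List (Fin d × Bool)) (hw : w.length ≤ m) :
    (wordEval X w, wordEval Y w) ∈ wordSpan X Y m :=
  Submodule.subset_span ⟨w, hw, rfl⟩

theorem letter_mem_wordSpan (i : Fin d) (hm : 1 ≤ m) : (X i, Y i) ∈ wordSpan X Y m := by
  simpa [wordEval] using
    wordEval_mem_wordSpan (X := X) (Y := Y) (m := m) [(i, false)] (by simpa using hm)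

theorem scalar_mem_wordSpan (a : K) :
    (Matrix.scalar (Fin n) a, Matrix.scalar (Fin n) a) ∈ wordSpan X Y m := by
  have := (wordSpan X Y m).smul_mem a (wordEval_mem_wordSpan [] (Nat.zero_le _))
  simpa [Prod.smul_mk, Matrix.smul_one_eq_diagonal] using this

theorem mul_mem_wordSpan {p q : Matrix (Fin n) (Fin n) K × Matrix (Fin n) (Fin n) K}
    (hp : p ∈ wordSpan X Y m) (hq : q ∈ wordSpan X Y m') : p * q ∈ wordSpan X Y (m + m') := by
  have h := Submodule.mul_mem_mul hp hq
  rw [wordSpan, wordSpan, Submodule.span_mul_span] at h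
  refine Submodule.span_mono ?_ h
  rintro _ ⟨_, ⟨v, hv, rfl⟩, _, ⟨w, hw, rfl⟩, rfl⟩
  refine ⟨v ++ w, ?_, by simp [wordEval_append]⟩
  simp only [Set.mem_ofPred_eq, List.length_append] at *
  omega

theorem transpose_mem_wordSpan {p : Matrix (Fin n) (Fin n) K × Matrix (Fin n) (Fin n) K}
    (hp : p ∈ wordSpan X Y m) : (p.1ᵀ, p.2ᵀ) ∈ wordSpan X Y m := by
  induction hp using Submodule.span_induction with
  | mem p hp =>
    obtain ⟨w, hw, rfl⟩ := hp
    simp only [← wordEval_transposeWord]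
    refine wordEval_mem_wordSpan _ ?_
    simpa [transposeWord] using hw
  | zero =>
    simp only [Prod.fst_zero, Prod.snd_zero, Matrix.transpose_zero]
    exact (wordSpan X Y m).zero_mem
  | add p q _ _ hp hq => simpa using (wordSpan X Y m).add_mem hp hq
  | smul a p _ hp => simpa using (wordSpan X Y m).smul_mem a hp

theorem TracesAgree.trace_eq (h : TracesAgree X Y m)
    {p : Matrix (Fin n) (Fin n) K × Matrix (Fin n) (Fin n) K}
    (hp : p ∈ wordSpan X Y m) : p.1.trace = p.2.trace := by
  induction hp using Submodule.span_induction with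
  | mem p hp => obtain ⟨w, hw, rfl⟩ := hp; exact h w hw
  | zero => simp
  | add p q _ _ hp hq => simp [hp, hq]
  | smul a p _ hp => simp [hp]

/-- For `p` in the span, `p pᵗ` is a combination of words of twice the length, and its trace decides
whether `p` vanishes. So the span of pairs is the graph of a linear bijection between its two
projections. -/
theorem TracesAgree.eq_zero_iff (hK : IsRealPythagorean K) (h : TracesAgree X Y (m + m))
    {p : Matrix (Fin n) (Fin n) K × Matrix (Fin n) (Fin n) K}
    (hp : p ∈ wordSpan X Y m) : p.1 = 0 ↔ p.2 = 0 := by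
  have h1 := h.trace_eq (mul_mem_wordSpan hp (transpose_mem_wordSpan hp))
  simp only [Prod.fst_mul, Prod.snd_mul] at h1
  constructor <;> intro h0 <;> refine hK.eq_zero_of_trace_mul_transpose ?_
  · rw [← h1, h0]; simp
  · rw [h1, h0]; simp

theorem TracesAgree.eq_iff (hK : IsRealPythagorean K) (h : TracesAgree X Y (m + m))
    {p q : Matrix (Fin n) (Fin n) K × Matrix (Fin n) (Fin n) K}
    (hp : p ∈ wordSpan X Y m) (hq : q ∈ wordSpan X Y m) : p.1 = q.1 ↔ p.2 = q.2 := by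
  rw [← sub_eq_zero, ← sub_eq_zero (a := p.2)]
  exact h.eq_zero_iff hK (sub_mem hp hq)

/-- Paired matrices are central simultaneously and with the same scalar, which is all that the new
symbols see. -/
theorem TracesAgree.eq_scalar_iff (hK : IsRealPythagorean K) (h : TracesAgree X Y (m + m))
    {p : Matrix (Fin n) (Fin n) K × Matrix (Fin n) (Fin n) K}
    (hp : p ∈ wordSpan X Y m) (a : K) :
    p.1 = Matrix.scalar (Fin n) a ↔ p.2 = Matrix.scalar (Fin n) a :=
  h.eq_iff hK hp (scalar_mem_wordSpan a)

end Words

/-! ### Reduction to tuples of bounded length -/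

section Reduction

variable {K : Type*} [Field K] {n : ℕ}

/-- The pairs of matrices that are conjugate under `O`. -/
def conjPairs (O : Matrix (Fin n) (Fin n) K) :
    Submodule K (Matrix (Fin n) (Fin n) K × Matrix (Fin n) (Fin n) K) where
  carrier := {p | Oᵀ * p.1 * O = p.2}
  add_mem' := by
    intro p q hp hq
    simp only [Set.mem_ofPred_eq, Prod.fst_add, Prod.snd_add, mul_add, add_mul] at *
    rw [hp, hq]
  zero_mem' := by simp
  smul_mem' := by
    intro a p hp
    simp only [Set.mem_ofPred_eq, Prod.smul_fst, Prod.smul_snd, Matrix.mul_smul,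
      Matrix.smul_mul] at *
    rw [hp]

/-- The number of pairs of matrices that suffice to span any space of such pairs. -/
def tupleBound (n : ℕ) : ℕ := n * n + n * n

/-- A basis chosen among the `p i` is padded with an arbitrary index to a length independent of `ι`.
As conjugation by a fixed matrix is linear, it need only be checked on the chosen pairs, even for
infinite `ι`. -/
theorem exists_spanning_tuple {ι : Type*} [Nonempty ι]
    (p : ι → Matrix (Fin n) (Fin n) K × Matrix (Fin n) (Fin n) K) :
    ∃ e : Fin (tupleBound n) → ι, ∀ i, p i ∈ Submodule.span K (Set.range (p ∘ e)) := by
  classical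
  obtain ⟨f, hf, hspan, -⟩ := Submodule.exists_fun_fin_finrank_span_eq K (Set.range p)
  choose e he using hf
  have hle : Module.finrank K (Submodule.span K (Set.range p)) ≤ tupleBound n := by
    refine (Submodule.finrank_le _).trans ?_
    simp [tupleBound, Module.finrank_prod, Module.finrank_matrix]
  refine ⟨fun i => if h : (i : ℕ) < Module.finrank K (Submodule.span K (Set.range p))
    then e ⟨i, h⟩ else Classical.arbitrary ι, fun i => ?_⟩
  have hi : p i ∈ Submodule.span K (Set.range f) := by
    rw [hspan]
    exact Submodule.subset_span (Set.mem_range_self i)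
  refine Submodule.span_mono ?_ hi
  rintro _ ⟨k, rfl⟩
  exact ⟨⟨k, k.2.trans_le hle⟩, by simp [he]⟩

/-- The Specht property for tuples of length `d` with words of length at most `D`. -/
def SpechtFor (K : Type*) [Field K] (n d D : ℕ) : Prop :=
  ∀ X Y : Fin d → Matrix (Fin n) (Fin n) K, TracesAgree X Y D →
    ∃ O : Matrix (Fin n) (Fin n) K, O * Oᵀ = 1 ∧ ∀ i, Oᵀ * X i * O = Y i

theorem spechtProperty_iff {F : Type u} [Field F] {n : ℕ} :
    SpechtProperty F n ↔ ∃ D, SpechtFor F n (tupleBound n) D := by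
  constructor
  · rintro ⟨D, h⟩
    exact ⟨D, h _⟩
  · rintro ⟨D, h⟩
    refine ⟨D, fun d X Y hXY => ?_⟩
    -- The empty tuple offers no index to pad with.
    rcases Nat.eq_zero_or_pos d with rfl | hd
    · exact ⟨1, by simp, fun i => i.elim0⟩
    have : Nonempty (Fin d) := ⟨⟨0, hd⟩⟩
    obtain ⟨e, he⟩ := exists_spanning_tuple fun i => (X i, Y i)
    obtain ⟨O, hO, hXYO⟩ := h (X ∘ e) (Y ∘ e) fun w hw => by
      have := hXY (w.map fun p => (e p.1, p.2)) (by simpa using hw)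
      simpa [wordEval, Function.comp_def] using this
    refine ⟨O, hO, fun i => ?_⟩
    have hle : Submodule.span F (Set.range ((fun i => (X i, Y i)) ∘ e)) ≤ conjPairs O := by
      rw [Submodule.span_le]
      rintro _ ⟨k, rfl⟩
      exact hXYO k
    exact hle (he i)

end Reduction

/-! ### The language of matrix structures -/

namespace MatLang

open Structure

variable {L : FirstOrder.Language.{v, w}}

/-- The symbols of the language of rings, in the language of matrix structures. -/
def ringFun {m : ℕ} (f : Language.ring.Functions m) : (matLang L).Functions m :=
  Sum.inl (Sum.inl f)

/-- The new function symbols, in the language of matrix structures. -/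
def newFun {m : ℕ} (f : L.Functions m) : (matLang L).Functions m :=
  Sum.inl (Sum.inr f)

/-- The new relation symbols, in the language of matrix structures. -/
def newRel {m : ℕ} (r : L.Relations m) : (matLang L).Relations m :=
  Sum.inl (Sum.inr r)

/-- The symbol for the trace. -/
def trFun : (matLang L).Functions 1 := Sum.inr TrInvFunc.tr

/-- The symbol for the transposition. -/
def invFun : (matLang L).Functions 1 := Sum.inr TrInvFunc.inv

theorem forall_functions {P : ∀ m : ℕ, (matLang L).Functions m → Prop}
    (hadd : P 2 (ringFun addFunc)) (hmul : P 2 (ringFun mulFunc)) (hneg : P 1 (ringFun negFunc))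
    (hzero : P 0 (ringFun zeroFunc)) (hone : P 0 (ringFun oneFunc))
    (hnew : ∀ m (f : L.Functions m), P m (newFun f)) (htr : P 1 trFun) (hinv : P 1 invFun)
    {m : ℕ} (f : (matLang L).Functions m) : P m f := by
  rcases f with (f | f) | f
  · cases f
    exacts [hadd, hmul, hneg, hzero, hone]
  · exact hnew _ f
  · cases f
    exacts [htr, hinv]

theorem forall_relations {P : ∀ m : ℕ, (matLang L).Relations m → Prop}
    (hnew : ∀ m (r : L.Relations m), P m (newRel r))
    {m : ℕ} (r : (matLang L).Relations m) : P m r := by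
  rcases r with (r | r) | r
  · exact r.elim
  · exact hnew _ r
  · exact r.elim

/-! ### Expanded fields -/

section FieldLang

variable {K : Type*} [Field K] [CompatibleRing K] [L.Structure K]

theorem fieldLang_funMap_add (a : Fin 2 → K) :
    funMap (L := fieldLang L) (Sum.inl ringFunc.add) a = a 0 + a 1 :=
  CompatibleRing.funMap_add a

theorem fieldLang_funMap_mul (a : Fin 2 → K) :
    funMap (L := fieldLang L) (Sum.inl ringFunc.mul) a = a 0 * a 1 :=
  CompatibleRing.funMap_mul a

theorem fieldLang_funMap_neg (a : Fin 1 → K) :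
    funMap (L := fieldLang L) (Sum.inl ringFunc.neg) a = -a 0 :=
  CompatibleRing.funMap_neg a

theorem fieldLang_funMap_zero (a : Fin 0 → K) :
    funMap (L := fieldLang L) (Sum.inl ringFunc.zero) a = 0 :=
  CompatibleRing.funMap_zero a

theorem fieldLang_funMap_one (a : Fin 0 → K) :
    funMap (L := fieldLang L) (Sum.inl ringFunc.one) a = 1 :=
  CompatibleRing.funMap_one a

/-- An embedding of expanded fields is a ring homomorphism. -/
def embeddingRingHom {K' : Type*} [Field K'] [CompatibleRing K'] [L.Structure K']
    (σ : K ↪[fieldLang L] K') : K →+* K' where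
  toFun := σ
  map_add' a b := by
    have := σ.map_fun (Sum.inl ringFunc.add : (fieldLang L).Functions 2) ![a, b]
    rwa [fieldLang_funMap_add, fieldLang_funMap_add] at this
  map_mul' a b := by
    have := σ.map_fun (Sum.inl ringFunc.mul : (fieldLang L).Functions 2) ![a, b]
    rwa [fieldLang_funMap_mul, fieldLang_funMap_mul] at this
  map_zero' := by
    have := σ.map_fun (Sum.inl ringFunc.zero : (fieldLang L).Functions 0) ![]
    rwa [fieldLang_funMap_zero, fieldLang_funMap_zero] at this
  map_one' := by
    have := σ.map_fun (Sum.inl ringFunc.one : (fieldLang L).Functions 0) ![]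
    rwa [fieldLang_funMap_one, fieldLang_funMap_one] at this

end FieldLang

/-! ### The matrix structures -/

section Interpretation

variable {n : ℕ} {K : Type*} [Field K] [L.Structure K]

@[simp]
theorem funMap_add (X : Fin 2 → Matrix (Fin n) (Fin n) K) :
    funMap (L := matLang L) (ringFun addFunc) X = X 0 + X 1 := rfl

@[simp]
theorem funMap_mul (X : Fin 2 → Matrix (Fin n) (Fin n) K) :
    funMap (L := matLang L) (ringFun mulFunc) X = X 0 * X 1 := rfl

@[simp]
theorem funMap_neg (X : Fin 1 → Matrix (Fin n) (Fin n) K) :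
    funMap (L := matLang L) (ringFun negFunc) X = -X 0 := rfl

@[simp]
theorem funMap_zero (X : Fin 0 → Matrix (Fin n) (Fin n) K) :
    funMap (L := matLang L) (ringFun zeroFunc) X = 0 := rfl

@[simp]
theorem funMap_one (X : Fin 0 → Matrix (Fin n) (Fin n) K) :
    funMap (L := matLang L) (ringFun oneFunc) X = 1 := rfl

@[simp]
theorem funMap_tr (X : Fin 1 → Matrix (Fin n) (Fin n) K) :
    funMap (L := matLang L) trFun X = Matrix.scalar (Fin n) (X 0).trace := rfl

@[simp]
theorem funMap_inv (X : Fin 1 → Matrix (Fin n) (Fin n) K) :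
    funMap (L := matLang L) invFun X = (X 0)ᵀ := rfl

theorem relMap_newRel {m : ℕ} (r : L.Relations m) (X : Fin m → Matrix (Fin n) (Fin n) K) :
    RelMap (L := matLang L) (newRel r) X ↔
      ∃ a : Fin m → K, (∀ i, X i = Matrix.scalar (Fin n) (a i)) ∧ RelMap r a := Iff.rfl

theorem funMap_newFun_of_not {m : ℕ} (f : L.Functions m) {X : Fin m → Matrix (Fin n) (Fin n) K}
    (h : ¬ ∃ a : Fin m → K, ∀ i, X i = Matrix.scalar (Fin n) (a i)) :
    funMap (L := matLang L) (newFun f) X = 0 :=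
  dif_neg h

theorem scalar_inj (hn : 0 < n) {a b : K} :
    Matrix.scalar (Fin n) a = Matrix.scalar (Fin n) b ↔ a = b := by
  have : Nonempty (Fin n) := ⟨⟨0, hn⟩⟩
  exact Matrix.scalar_inj

/-- For `n > 0` scalars are determined by their matrices, so the preimage chosen in the definition
is `a`. -/
theorem funMap_newFun_scalar (hn : 0 < n) {m : ℕ} (f : L.Functions m)
    {X : Fin m → Matrix (Fin n) (Fin n) K} {a : Fin m → K}
    (h : ∀ i, X i = Matrix.scalar (Fin n) (a i)) :
    funMap (L := matLang L) (newFun f) X = Matrix.scalar (Fin n) (funMap f a) := by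
  have h' : ∃ a : Fin m → K, ∀ i, X i = Matrix.scalar (Fin n) (a i) := ⟨a, h⟩
  have ha : h'.choose = a := by
    ext i
    rw [← scalar_inj hn, ← h'.choose_spec i, h i]
  rw [← ha]
  exact dif_pos h'

theorem relMap_newRel_scalar (hn : 0 < n) {m : ℕ} (r : L.Relations m)
    {X : Fin m → Matrix (Fin n) (Fin n) K} {a : Fin m → K}
    (h : ∀ i, X i = Matrix.scalar (Fin n) (a i)) :
    RelMap (L := matLang L) (newRel r) X ↔ RelMap r a := by
  rw [relMap_newRel]
  constructor
  · rintro ⟨b, hb, hr⟩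
    have : b = a := by
      ext i
      rw [← scalar_inj hn, ← hb i, h i]
    rwa [← this]
  · exact fun hr => ⟨a, h, hr⟩

theorem exists_scalar_iff {k : ℕ} (i₀ : Fin n) (X : Fin k → Matrix (Fin n) (Fin n) K) :
    (∃ a : Fin k → K, ∀ i, X i = Matrix.scalar (Fin n) (a i)) ↔
      ∀ i, X i = Matrix.scalar (Fin n) (X i i₀ i₀) := by
  refine ⟨fun ⟨a, ha⟩ i => ?_, fun h => ⟨_, h⟩⟩
  have : X i i₀ i₀ = a i := by simp [ha i]
  rw [this, ← ha i]

/-- Entrywise application of an embedding of expanded fields, followed by conjugation. -/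
theorem exists_embedding_of_conj {K' : Type*} [Field K'] [L.Structure K']
    [CompatibleRing K] [CompatibleRing K'] (hn : 0 < n) (σ : K ↪[fieldLang L] K')
    (O : Matrix (Fin n) (Fin n) K') (hO : O * Oᵀ = 1) :
    ∃ g : Matrix (Fin n) (Fin n) K ↪[matLang L] Matrix (Fin n) (Fin n) K',
      ∀ X, g X = Oᵀ * X.map σ * O := by
  have hO' : Oᵀ * O = 1 := mul_eq_one_comm.mp hO
  have hcancel : ∀ A B : Matrix (Fin n) (Fin n) K', Oᵀ * A * O = B → A = O * B * Oᵀ := by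
    rintro A _ rfl
    simp only [← Matrix.mul_assoc, hO, Matrix.one_mul]
    rw [Matrix.mul_assoc, hO, Matrix.mul_one]
  have hcomm : ∀ (b : K') (A : Matrix (Fin n) (Fin n) K'),
      A * Matrix.scalar (Fin n) b = Matrix.scalar (Fin n) b * A :=
    fun b A => (Matrix.scalar_commute b (fun _ => Commute.all _ _) A).symm
  let s : K →+* K' := embeddingRingHom σ
  let g : Matrix (Fin n) (Fin n) K → Matrix (Fin n) (Fin n) K' := fun X => Oᵀ * s.mapMatrix X * O
  have hg : ∀ X, g X = Oᵀ * s.mapMatrix X * O := fun _ => rfl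
  have hscalar : ∀ a, g (Matrix.scalar (Fin n) a) = Matrix.scalar (Fin n) (σ a) := by
    intro a
    have : s.mapMatrix (Matrix.scalar (Fin n) a) = Matrix.scalar (Fin n) (s a) := by
      ext i j
      by_cases h : i = j <;> simp [h]
    rw [hg, this, hcomm, Matrix.mul_assoc, hO', Matrix.mul_one]
    rfl
  have hinj : Function.Injective g := by
    intro X Y h
    have := hcancel _ _ h
    rw [hg, ← hcancel _ _ rfl] at this
    exact Matrix.map_injective s.injective this
  -- Noncentral arguments must stay noncentral, where new functions are `0` and new relations fail.
  -- The scalar `b` comes from `K` because it is the image of an entry of `X`.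
  have hcentral : ∀ X b, g X = Matrix.scalar (Fin n) b → ∃ a, X = Matrix.scalar (Fin n) a := by
    intro X b h
    have h1 := hcancel _ _ h
    rw [hcomm, Matrix.mul_assoc, hO,
      Matrix.mul_one] at h1
    refine ⟨X ⟨0, hn⟩ ⟨0, hn⟩, Matrix.map_injective s.injective ?_⟩
    have h2 : s.mapMatrix X = Matrix.scalar (Fin n) b := h1
    have h3 : s (X ⟨0, hn⟩ ⟨0, hn⟩) = b := by
      simpa using congrFun (congrFun h2 ⟨0, hn⟩) ⟨0, hn⟩
    change s.mapMatrix X = s.mapMatrix _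
    rw [h2, ← h3]
    ext i j
    by_cases h : i = j <;> simp [h]
  refine ⟨⟨⟨g, hinj⟩, fun f => ?_, fun r => ?_⟩, fun _ => rfl⟩
  · induction f using forall_functions with
    | hadd =>
      intro X
      simp only [Function.comp_apply, funMap_add, hg, map_add, mul_add, add_mul]
    | hmul =>
      intro X
      simp only [Function.comp_apply, funMap_mul, hg, map_mul, Matrix.mul_assoc]
      rw [← Matrix.mul_assoc O, hO, Matrix.one_mul]
    | hneg =>
      intro X
      simp only [Function.comp_apply, funMap_neg, hg, map_neg, mul_neg, neg_mul]
    | hzero => intro X; simp [hg]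
    | hone => intro X; simp [hg, hO']
    | hnew k f =>
      intro X
      by_cases hX : ∃ a : Fin k → K, ∀ i, X i = Matrix.scalar (Fin n) (a i)
      · obtain ⟨a, ha⟩ := hX
        rw [funMap_newFun_scalar hn f ha, funMap_newFun_scalar (a := σ ∘ a) hn f]
        · refine (hscalar _).trans (congrArg _ ?_)
          exact σ.map_fun (Sum.inr f : (fieldLang L).Functions k) a
        · intro i
          simp only [Function.comp_apply, ha, hscalar]
      · rw [funMap_newFun_of_not f hX, funMap_newFun_of_not f]
        · simp [hg]
        · rintro ⟨b, hb⟩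
          choose a ha using fun i => hcentral _ _ (hb i)
          exact hX ⟨a, ha⟩
    | htr =>
      intro X
      simp only [funMap_tr, Function.comp_apply]
      refine (hscalar _).trans (congrArg _ ?_)
      change s _ = (g _).trace
      rw [hg, Matrix.mul_assoc, Matrix.trace_mul_comm, Matrix.mul_assoc, hO, Matrix.mul_one]
      simp [Matrix.trace]
    | hinv =>
      intro X
      simp only [funMap_inv, Function.comp_apply]
      simp only [hg, Matrix.transpose_mul, Matrix.transpose_transpose, Matrix.mul_assoc]
      rfl
  · induction r using forall_relations with
    | hnew k r =>
      intro X
      by_cases hX : ∃ a : Fin k → K, ∀ i, X i = Matrix.scalar (Fin n) (a i)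
      · obtain ⟨a, ha⟩ := hX
        rw [relMap_newRel_scalar hn r ha, relMap_newRel_scalar (a := σ ∘ a) hn r]
        · exact σ.map_rel (Sum.inr r : (fieldLang L).Relations k) a
        · intro i
          simp only [Function.comp_apply, ha, hscalar]
      · simp only [relMap_newRel]
        constructor
        · rintro ⟨b, hb, -⟩
          choose a ha using fun i => hcentral _ _ (hb i)
          exact absurd ⟨a, ha⟩ hX
        · rintro ⟨a, ha, -⟩
          exact absurd ⟨a, ha⟩ hX

end Interpretation

/-! ### Compatibility with spans of words -/

section WordSpan

variable {n d : ℕ} {K : Type*} [Field K] [L.Structure K]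
  {X Y : Fin d → Matrix (Fin n) (Fin n) K} {m : ℕ}

/-- Only multiplication lengthens words. Agreement up to `m + m` is also what ensures that new
functions see the same central arguments; their values are scalars, which lie in every span. -/
theorem funMap_mem_wordSpan (hK : IsRealPythagorean K) (hn : 0 < n)
    (h : TracesAgree X Y (m + m)) {k : ℕ} (f : (matLang L).Functions k)
    {A B : Fin k → Matrix (Fin n) (Fin n) K} (hAB : ∀ i, (A i, B i) ∈ wordSpan X Y m) :
    (funMap f A, funMap f B) ∈ wordSpan X Y (m + m) := by
  have hm : wordSpan X Y m ≤ wordSpan X Y (m + m) := wordSpan_mono (Nat.le_add_left _ _)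
  revert A B
  induction f using forall_functions with
  | hadd => exact fun hAB => hm (add_mem (hAB 0) (hAB 1))
  | hmul => exact fun hAB => mul_mem_wordSpan (hAB 0) (hAB 1)
  | hneg => exact fun hAB => hm (neg_mem (hAB 0))
  | hzero => exact fun _ => (wordSpan X Y (m + m)).zero_mem
  | hone =>
    exact fun _ => by
      simpa using wordEval_mem_wordSpan (X := X) (Y := Y) [] (Nat.zero_le (m + m))
  | hnew k f =>
    intro A B hAB
    by_cases hA : ∃ a : Fin k → K, ∀ i, A i = Matrix.scalar (Fin n) (a i)
    · obtain ⟨a, ha⟩ := hA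
      rw [funMap_newFun_scalar hn f ha,
        funMap_newFun_scalar hn f fun i => (h.eq_scalar_iff hK (hAB i) _).1 (ha i)]
      exact scalar_mem_wordSpan _
    · have hB : ¬ ∃ a : Fin k → K, ∀ i, B i = Matrix.scalar (Fin n) (a i) := fun ⟨a, ha⟩ =>
        hA ⟨a, fun i => (h.eq_scalar_iff hK (hAB i) _).2 (ha i)⟩
      rw [funMap_newFun_of_not f hA, funMap_newFun_of_not f hB]
      exact (wordSpan X Y (m + m)).zero_mem
  | htr =>
    intro A B hAB
    have := (h.mono (Nat.le_add_left m m)).trace_eq (hAB 0)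
    simp only [funMap_tr] at this ⊢
    rw [this]
    exact scalar_mem_wordSpan _
  | hinv => exact fun hAB => hm (transpose_mem_wordSpan (hAB 0))

theorem relMap_iff_of_mem_wordSpan (hK : IsRealPythagorean K)
    (h : TracesAgree X Y (m + m)) {k : ℕ} (r : (matLang L).Relations k)
    {A B : Fin k → Matrix (Fin n) (Fin n) K} (hAB : ∀ i, (A i, B i) ∈ wordSpan X Y m) :
    RelMap r A ↔ RelMap r B := by
  revert A B
  induction r using forall_relations with
  | hnew k r =>
    intro A B hAB
    simp only [relMap_newRel]
    exact exists_congr fun a => and_congr_left fun _ =>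
      forall_congr' fun i => h.eq_scalar_iff hK (hAB i) _

/-- The bound depends on the term alone and doubles at each function symbol. -/
theorem exists_realize_term_mem_wordSpan (hK : IsRealPythagorean K) (hn : 0 < n) {α : Type*}
    (t : (matLang L).Term α) :
    ∃ m, ∀ (X Y : Fin d → Matrix (Fin n) (Fin n) K) (a b : α → Matrix (Fin n) (Fin n) K),
      (∀ i, (a i, b i) ∈ wordSpan X Y 1) → TracesAgree X Y m →
        (t.realize a, t.realize b) ∈ wordSpan X Y m := by
  induction t with
  | var i => exact ⟨1, fun X Y a b hab _ => hab i⟩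
  | @func k f ts ih =>
    choose M hM using ih
    have hle : ∀ i, M i ≤ Finset.univ.sup M := fun i => Finset.le_sup (Finset.mem_univ i)
    refine ⟨Finset.univ.sup M + Finset.univ.sup M, fun X Y a b hab h => ?_⟩
    exact funMap_mem_wordSpan hK hn h f fun i => wordSpan_mono (hle i)
      (hM i X Y a b hab (h.mono ((hle i).trans (Nat.le_add_left _ _))))

/-- Uniformity of `D` in the tuples is the point: it becomes the Specht bound. -/
theorem exists_realize_iff_of_tracesAgree (hK : IsRealPythagorean K) (hn : 0 < n) {α : Type*}
    {φ : (matLang L).Formula α} (hφ : BoundedFormula.IsQF φ) :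
    ∃ D, ∀ (X Y : Fin d → Matrix (Fin n) (Fin n) K) (a b : α → Matrix (Fin n) (Fin n) K),
      (∀ i, (a i, b i) ∈ wordSpan X Y 1) → TracesAgree X Y D →
        (φ.Realize a ↔ φ.Realize b) := by
  unfold Formula.Realize
  induction hφ with
  | falsum => exact ⟨0, fun X Y a b _ _ => Iff.rfl⟩
  | of_isAtomic h =>
    have hvar : ∀ {X Y : Fin d → Matrix (Fin n) (Fin n) K} {a b : α → Matrix (Fin n) (Fin n) K},
        (∀ i, (a i, b i) ∈ wordSpan X Y 1) → ∀ i : α ⊕ Fin 0,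
          (Sum.elim a default i, Sum.elim b default i) ∈ wordSpan X Y 1 := by
      rintro X Y a b hab (i | i)
      · exact hab i
      · exact i.elim0
    cases h with
    | equal t₁ t₂ =>
      obtain ⟨m₁, h₁⟩ := exists_realize_term_mem_wordSpan (d := d) (K := K) hK hn t₁
      obtain ⟨m₂, h₂⟩ := exists_realize_term_mem_wordSpan (d := d) (K := K) hK hn t₂
      refine ⟨max m₁ m₂ + max m₁ m₂, fun X Y a b hab h => ?_⟩
      simp only [BoundedFormula.realize_bdEqual]
      exact h.eq_iff hK
        (wordSpan_mono (le_max_left _ _) (h₁ X Y _ _ (hvar hab) (h.mono (by omega))))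
        (wordSpan_mono (le_max_right _ _) (h₂ X Y _ _ (hvar hab) (h.mono (by omega))))
    | rel r ts =>
      choose M hM using fun i => exists_realize_term_mem_wordSpan (d := d) (K := K) hK hn (ts i)
      have hle : ∀ i, M i ≤ Finset.univ.sup M := fun i => Finset.le_sup (Finset.mem_univ i)
      refine ⟨Finset.univ.sup M + Finset.univ.sup M, fun X Y a b hab h => ?_⟩
      simp only [BoundedFormula.realize_rel]
      exact relMap_iff_of_mem_wordSpan hK h r fun i => wordSpan_mono (hle i)
        (hM i X Y _ _ (hvar hab) (h.mono ((hle i).trans (Nat.le_add_left _ _))))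
  | imp _ _ ih₁ ih₂ =>
    obtain ⟨D₁, h₁⟩ := ih₁
    obtain ⟨D₂, h₂⟩ := ih₂
    refine ⟨max D₁ D₂, fun X Y a b hab h => ?_⟩
    simp only [BoundedFormula.realize_imp]
    exact imp_congr (h₁ X Y a b hab (h.mono (le_max_left _ _)))
      (h₂ X Y a b hab (h.mono (le_max_right _ _)))

end WordSpan

/-! ### Quantifier-free formulas on the center -/

section Center

variable {n : ℕ} {K : Type*} [Field K] [CompatibleRing K] [L.Structure K]

/-- The inclusion of the language of the expanded field. -/
def ofField : fieldLang L →ᴸ matLang L := LHom.sumInl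

theorem realize_onTerm_scalar (hn : 0 < n) {α : Type*} (t : (fieldLang L).Term α) (a : α → K) :
    (ofField.onTerm t).realize (fun i => Matrix.scalar (Fin n) (a i)) =
      Matrix.scalar (Fin n) (t.realize a) := by
  induction t with
  | var i => rfl
  | @func k f ts ih =>
    simp only [LHom.onTerm, Term.realize, ih]
    rcases f with f | f
    · cases f
      · rw [fieldLang_funMap_add, map_add]; rfl
      · rw [fieldLang_funMap_mul, map_mul]; rfl
      · rw [fieldLang_funMap_neg, map_neg]; rfl
      · rw [fieldLang_funMap_zero, map_zero]; rfl
      · rw [fieldLang_funMap_one, map_one]; rfl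
    · exact funMap_newFun_scalar hn f fun _ => rfl

/-- Confined to quantifier-free formulas, since after translation quantifiers would range over all
matrices. -/
theorem realize_onFormula_scalar (hn : 0 < n) {α : Type*} {φ : (fieldLang L).Formula α}
    (hφ : BoundedFormula.IsQF φ) (a : α → K) :
    (ofField.onFormula φ).Realize (fun i => Matrix.scalar (Fin n) (a i)) ↔ φ.Realize a := by
  unfold Formula.Realize LHom.onFormula
  have helim : (Sum.elim (fun i => Matrix.scalar (Fin n) (a i)) default :
      α ⊕ Fin 0 → Matrix (Fin n) (Fin n) K) =
        fun i => Matrix.scalar (Fin n) ((Sum.elim a default : α ⊕ Fin 0 → K) i) := by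
    ext1 (i | i)
    · rfl
    · exact i.elim0
  induction hφ with
  | falsum => exact Iff.rfl
  | of_isAtomic h =>
    cases h with
    | equal t₁ t₂ =>
      simp only [Term.bdEqual, LHom.onBoundedFormula, BoundedFormula.Realize, helim,
        realize_onTerm_scalar hn, scalar_inj hn]
    | rel r ts =>
      rcases r with r | r
      · exact r.elim
      simp only [Relations.boundedFormula, LHom.onBoundedFormula, BoundedFormula.Realize, helim]
      exact relMap_newRel_scalar hn r fun i => realize_onTerm_scalar hn _ _
  | imp _ _ ih₁ ih₂ => exact imp_congr ih₁ ih₂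

end Center

theorem isQF_onBoundedFormula {L₁ L₂ : FirstOrder.Language} (g : L₁ →ᴸ L₂) {α : Type*} {k : ℕ}
    {φ : L₁.BoundedFormula α k} (hφ : φ.IsQF) : (g.onBoundedFormula φ).IsQF := by
  induction hφ with
  | falsum => exact .falsum
  | of_isAtomic h =>
    cases h with
    | equal t₁ t₂ => exact (BoundedFormula.IsAtomic.equal _ _).isQF
    | rel r ts => exact (BoundedFormula.IsAtomic.rel _ _).isQF
  | imp _ _ ih₁ ih₂ => exact ih₁.imp ih₂

theorem isQF_subst {L₁ : FirstOrder.Language} {α β : Type*} {k : ℕ}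
    {φ : L₁.BoundedFormula α k} (hφ : φ.IsQF) (f : α → L₁.Term β) : (φ.subst f).IsQF := by
  induction hφ with
  | falsum => exact .falsum
  | of_isAtomic h =>
    cases h with
    | equal t₁ t₂ => exact (BoundedFormula.IsAtomic.equal _ _).isQF
    | rel r ts => exact (BoundedFormula.IsAtomic.rel _ _).isQF
  | imp _ _ ih₁ ih₂ => exact ih₁.imp ih₂

end MatLang

theorem HasQE.exists_isQF {L : FirstOrder.Language.{v, w}} {M : Type u} [L.Structure M]
    (h : HasQE L M) {α : Type*} [Finite α] (φ : L.Formula α) :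
    ∃ ψ : L.Formula α, BoundedFormula.IsQF ψ ∧ ∀ a : α → M, φ.Realize a ↔ ψ.Realize a := by
  obtain ⟨k, ⟨e⟩⟩ := Finite.exists_equiv_fin α
  obtain ⟨ψ, hψ, hφψ⟩ := h k (φ.relabel e)
  refine ⟨ψ.relabel e.symm, hψ.relabel _, fun a => ?_⟩
  rw [Formula.realize_relabel, ← hφψ, Formula.realize_relabel]
  simp [Function.comp_def]

namespace MatLang

/-! ### Terms -/

section Terms

variable {L : FirstOrder.Language.{v, w}} {α : Type*}

/-- The product of two terms. -/
def mulTerm (s t : (matLang L).Term α) : (matLang L).Term α := (ringFun mulFunc).apply₂ s t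

/-- The transpose of a term. -/
def invTerm (t : (matLang L).Term α) : (matLang L).Term α := invFun.apply₁ t

/-- The trace of a term. -/
def trTerm (t : (matLang L).Term α) : (matLang L).Term α := trFun.apply₁ t

/-- The term `0`. -/
def zeroTerm : (matLang L).Term α := Term.func (ringFun zeroFunc) ![]

/-- The term `1`. -/
def oneTerm : (matLang L).Term α := Term.func (ringFun oneFunc) ![]

/-- The sum of a list of terms. -/
def sumTerm (l : List ((matLang L).Term α)) : (matLang L).Term α :=
  l.foldr (fun s t => (ringFun addFunc).apply₂ s t) zeroTerm

/-- The term for a word. -/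
def wordTerm {d : ℕ} (w : List (Fin d × Bool)) : (matLang L).Term (Fin d) :=
  w.foldr (fun p t => mulTerm (if p.2 then invTerm (.var p.1) else .var p.1) t) oneTerm

variable {n : ℕ} {K : Type*} [Field K] [L.Structure K] (a : α → Matrix (Fin n) (Fin n) K)

@[simp]
theorem realize_mulTerm (s t : (matLang L).Term α) :
    (mulTerm s t).realize a = s.realize a * t.realize a := by
  rw [mulTerm, Term.realize_functions_apply₂, funMap_mul]; rfl

@[simp]
theorem realize_invTerm (t : (matLang L).Term α) :
    (invTerm t).realize a = (t.realize a)ᵀ := by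
  rw [invTerm, Term.realize_functions_apply₁, funMap_inv]; rfl

@[simp]
theorem realize_trTerm (t : (matLang L).Term α) :
    (trTerm t).realize a = Matrix.scalar (Fin n) (t.realize a).trace := by
  rw [trTerm, Term.realize_functions_apply₁, funMap_tr]; rfl

@[simp]
theorem realize_zeroTerm : (zeroTerm : (matLang L).Term α).realize a = 0 := rfl

@[simp]
theorem realize_oneTerm : (oneTerm : (matLang L).Term α).realize a = 1 := rfl

@[simp]
theorem realize_sumTerm (l : List ((matLang L).Term α)) :
    (sumTerm l).realize a = (l.map fun t => t.realize a).sum := by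
  induction l with
  | nil => rfl
  | cons t l ih =>
    rw [List.map_cons, List.sum_cons, ← ih, sumTerm, List.foldr_cons,
      Term.realize_functions_apply₂, funMap_add]
    rfl

@[simp]
theorem realize_wordTerm {d : ℕ} (w : List (Fin d × Bool))
    (X : Fin d → Matrix (Fin n) (Fin n) K) :
    (wordTerm w : (matLang L).Term (Fin d)).realize X = wordEval X w := by
  induction w with
  | nil => rfl
  | cons p w ih =>
    rw [wordEval_cons, ← ih, wordTerm, List.foldr_cons, realize_mulTerm]
    congr 1
    split_ifs <;> simp

end Terms

/-! ### Quantifier elimination implies the Specht property -/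

section Column

variable {L : FirstOrder.Language.{v, w}} {n d : ℕ}

/-- The formula `∃ G, …` which says that the matrices `X` have the entries `c` with respect to
some system of matrix units whose first column is `G`. -/
noncomputable def columnFormula (L : FirstOrder.Language.{v, w}) (d : ℕ) (i₀ : Fin n) :
    (matLang L).Formula (Fin d ⊕ Fin d × Fin n × Fin n) :=
  let X : Fin d → (matLang L).Term ((Fin d ⊕ Fin d × Fin n × Fin n) ⊕ Fin n) :=
    fun k => .var (.inl (.inl k))
  let c : Fin d × Fin n × Fin n → (matLang L).Term ((Fin d ⊕ Fin d × Fin n × Fin n) ⊕ Fin n) :=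
    fun p => .var (.inl (.inr p))
  let G : Fin n → (matLang L).Term ((Fin d ⊕ Fin d × Fin n × Fin n) ⊕ Fin n) :=
    fun i => .var (.inr i)
  Formula.iExs (Fin n) <|
    (Formula.iInf fun p : Fin n × Fin n =>
      (mulTerm (invTerm (G p.1)) (G p.2)).equal (if p.1 = p.2 then G i₀ else zeroTerm)) ⊓
    ((∼ ((G i₀).equal zeroTerm)) ⊓
    Formula.iInf fun p : Fin d × Fin n =>
      (mulTerm (X p.1) (G p.2)).equal
        (sumTerm (List.ofFn fun j => mulTerm (c (p.1, j, p.2)) (G j))))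

theorem realize_columnFormula {K : Type*} [Field K] [L.Structure K] (i₀ : Fin n)
    (X : Fin d → Matrix (Fin n) (Fin n) K) (c : Fin d → Matrix (Fin n) (Fin n) K) :
    (columnFormula L d i₀).Realize
        (Sum.elim X fun p => Matrix.scalar (Fin n) (c p.1 p.2.1 p.2.2)) ↔
      ∃ G : Fin n → Matrix (Fin n) (Fin n) K,
        (∀ i j, (G i)ᵀ * G j = if i = j then G i₀ else 0) ∧ G i₀ ≠ 0 ∧
          ∀ k i, X k * G i = ∑ j, c k j i • G j := by
  rw [columnFormula, Formula.realize_iExs]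
  refine exists_congr fun G => ?_
  rw [Formula.realize_inf, Formula.realize_inf, Formula.realize_iInf, Formula.realize_iInf,
    Formula.realize_not, Prod.forall, Prod.forall]
  refine and_congr (forall₂_congr fun i j => ?_) (and_congr ?_ (forall₂_congr fun k i => ?_))
  · rw [Formula.realize_equal, realize_mulTerm, realize_invTerm]
    split_ifs <;> simp
  · rw [Formula.realize_equal]
    simp
  · rw [Formula.realize_equal]
    simp [List.sum_ofFn, ← Matrix.smul_eq_diagonal_mul]

theorem spechtProperty_of_hasQE {F : Type u} [Field F] [L.Structure F]
    (hF : IsRealPythagorean F) (hn : 0 < n) (h : HasQE (matLang L) (Matrix (Fin n) (Fin n) F)) :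
    SpechtProperty F n := by
  rw [spechtProperty_iff]
  have i₀ : Fin n := ⟨0, hn⟩
  obtain ⟨ψ, hψ, hφψ⟩ := h.exists_isQF (columnFormula L (tupleBound n) i₀)
  obtain ⟨D, hD⟩ := exists_realize_iff_of_tracesAgree (d := tupleBound n) hF hn hψ
  refine ⟨D, fun X Y hXY => ?_⟩
  -- `X` has its own entries with respect to the standard matrix units.
  have hX := (realize_columnFormula (L := L) i₀ X X).2
    ⟨fun i => Matrix.single i i₀ 1, single_column_transpose_mul i₀, by
      intro h0
      simpa using congrFun (congrFun h0 i₀) i₀, fun k i => mul_single_column i₀ i (X k)⟩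
  -- The parameters remain the entries of `X`; as scalars they are paired with themselves in the
  -- span.
  have hY := (hφψ _).2 ((hD X Y _ (Sum.elim Y fun p => Matrix.scalar (Fin n) (X p.1 p.2.1 p.2.2))
    (by
      rintro (i | i)
      · exact letter_mem_wordSpan i le_rfl
      · exact scalar_mem_wordSpan _) hXY).1 ((hφψ _).1 hX))
  obtain ⟨G, hG, hG0, hYG⟩ := (realize_columnFormula i₀ Y X).1 hY
  obtain ⟨O, hO, hconj⟩ := hF.exists_orthogonal_of_column i₀ G hG hG0
  -- The matrix `O` carries `Y` to `X`, so its transpose is the one required.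
  refine ⟨Oᵀ, by rw [Matrix.transpose_transpose]; exact mul_eq_one_comm.mp hO, fun k => ?_⟩
  rw [Matrix.transpose_transpose, ← hconj (X k) (Y k) (hYG k)]
  simp only [← Matrix.mul_assoc, hO, Matrix.one_mul]
  rw [Matrix.mul_assoc, hO, Matrix.mul_one]

end Column

end MatLang

/-! ### Polynomial formulas -/

namespace MatFormula

section EntryVal

variable {α γ : Type*} {n : ℕ}

/-- The entries of a family of matrices, as a family of field elements. -/
def entryVal {R : Type*} (Z : α → Matrix (Fin n) (Fin n) R) : α × Fin n × Fin n → R :=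
  fun p => Z p.1 p.2.1 p.2.2

/-- The family of matrices with the given entries. -/
def ofEntryVal {R : Type*} (v : α × Fin n × Fin n → R) : α → Matrix (Fin n) (Fin n) R :=
  fun a => Matrix.of fun i j => v (a, i, j)

@[simp]
theorem entryVal_ofEntryVal {R : Type*} (v : α × Fin n × Fin n → R) :
    entryVal (ofEntryVal v) = v := rfl

variable {L' : FirstOrder.Language.{v, w}}

/-- Existential quantification over the entries of a finite family of matrices. -/
noncomputable def exMat [Finite γ] (φ : L'.Formula ((α ⊕ γ) × Fin n × Fin n)) :
    L'.Formula (α × Fin n × Fin n) :=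
  (φ.relabel (Equiv.sumProdDistrib α γ (Fin n × Fin n))).iExs (γ × Fin n × Fin n)

theorem realize_exMat [Finite γ] {M : Type*} [L'.Structure M]
    (φ : L'.Formula ((α ⊕ γ) × Fin n × Fin n)) (Z : α → Matrix (Fin n) (Fin n) M) :
    (exMat φ).Realize (entryVal Z) ↔
      ∃ W : γ → Matrix (Fin n) (Fin n) M, φ.Realize (entryVal (Sum.elim Z W)) := by
  have key : ∀ W : γ → Matrix (Fin n) (Fin n) M,
      Sum.elim (entryVal Z) (entryVal W) ∘ Equiv.sumProdDistrib α γ (Fin n × Fin n) =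
        entryVal (Sum.elim Z W) := by
    intro W
    ext ⟨a | c, i, j⟩ <;> rfl
  rw [exMat, Formula.realize_iExs]
  constructor
  · rintro ⟨W, hW⟩
    refine ⟨ofEntryVal W, ?_⟩
    rwa [Formula.realize_relabel, ← entryVal_ofEntryVal W, key] at hW
  · rintro ⟨W, hW⟩
    refine ⟨entryVal W, ?_⟩
    rwa [Formula.realize_relabel, key]

end EntryVal

section Polynomial

variable {α β : Type*} {n d : ℕ}

/-- The equation of two polynomials. -/
noncomputable def polyEq (p q : FreeCommRing β) : Language.ring.Formula β :=
  (termOfFreeCommRing p).equal (termOfFreeCommRing q)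

/-- The equation of two matrices of polynomials. -/
noncomputable def matEq (A B : Matrix (Fin n) (Fin n) (FreeCommRing β)) :
    Language.ring.Formula β :=
  Formula.iInf fun p : Fin n × Fin n => polyEq (A p.1 p.2) (B p.1 p.2)

/-- The generic matrices. -/
def gen (a : α) : Matrix (Fin n) (Fin n) (FreeCommRing (α × Fin n × Fin n)) :=
  Matrix.of fun i j => FreeCommRing.of (a, i, j)

/-- The value of a word at matrices over a commutative ring. -/
def ringWordEval {R : Type*} [CommRing R] (X : Fin d → Matrix (Fin n) (Fin n) R)
    (w : List (Fin d × Bool)) : Matrix (Fin n) (Fin n) R :=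
  (w.map fun p => if p.2 then (X p.1)ᵀ else X p.1).prod

theorem mapMatrix_ringWordEval {R K : Type*} [CommRing R] [Field K] (f : R →+* K)
    (X : Fin d → Matrix (Fin n) (Fin n) R) (w : List (Fin d × Bool)) :
    f.mapMatrix (ringWordEval X w) = wordEval (fun i => f.mapMatrix (X i)) w := by
  rw [ringWordEval, wordEval, map_list_prod, List.map_map]
  congr 2
  ext1 p
  simp only [Function.comp_apply]
  split_ifs <;> rfl

variable {K : Type*} [Field K]

theorem mapMatrix_gen (Z : α → Matrix (Fin n) (Fin n) K) (a : α) :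
    (FreeCommRing.lift (entryVal Z)).mapMatrix (gen a) = Z a := by
  ext i j
  simp [gen, entryVal]

/-- The trace of a word is an integer polynomial in the entries, so conditions on traces can be
written with ring terms. -/
theorem map_trace_ringWordEval {α : Type*} (Z : α → Matrix (Fin n) (Fin n) K) (e : Fin d → α)
    (w : List (Fin d × Bool)) :
    FreeCommRing.lift (entryVal Z) (ringWordEval (fun i => gen (e i)) w).trace =
      (wordEval (fun i => Z (e i)) w).trace := by
  have := mapMatrix_ringWordEval (FreeCommRing.lift (entryVal Z)) (fun i => gen (e i)) w
  simp only [mapMatrix_gen] at this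
  rw [← this]
  simp [Matrix.trace]

variable [CompatibleRing K]

@[simp]
theorem realize_polyEq (p q : FreeCommRing β) (v : β → K) :
    (polyEq p q).Realize v ↔ FreeCommRing.lift v p = FreeCommRing.lift v q := by
  simp [polyEq]

@[simp]
theorem realize_matEq (A B : Matrix (Fin n) (Fin n) (FreeCommRing β)) (v : β → K) :
    (matEq A B).Realize v ↔
      (FreeCommRing.lift v).mapMatrix A = (FreeCommRing.lift v).mapMatrix B := by
  simp [matEq, Formula.realize_iInf, ← Matrix.ext_iff]

/-! ### The Specht property as a first-order sentence -/

/-- The formula which says that the traces of a word at two tuples agree. -/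
noncomputable def traceFormula (n : ℕ) {d : ℕ} (w : List (Fin d × Bool)) :
    Language.ring.Formula ((Fin d ⊕ Fin d) × Fin n × Fin n) :=
  polyEq (ringWordEval (fun i => gen (Sum.inl i)) w).trace
    (ringWordEval (fun i => gen (Sum.inr i)) w).trace

theorem realize_traceFormula (w : List (Fin d × Bool)) (X Y : Fin d → Matrix (Fin n) (Fin n) K) :
    (traceFormula n w).Realize (entryVal (Sum.elim X Y)) ↔
      (wordEval X w).trace = (wordEval Y w).trace := by
  rw [traceFormula, realize_polyEq, map_trace_ringWordEval, map_trace_ringWordEval]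
  rfl

/-- The formula which says that two tuples are conjugate under an orthogonal matrix. -/
noncomputable def conjFormula (n d : ℕ) :
    Language.ring.Formula ((Fin d ⊕ Fin d) × Fin n × Fin n) :=
  exMat (γ := Unit) <|
    matEq (gen (.inr ()) * (gen (.inr ()))ᵀ) 1 ⊓
    Formula.iInf fun i : Fin d =>
      matEq ((gen (.inr ()))ᵀ * gen (.inl (.inl i)) * gen (.inr ())) (gen (.inl (.inr i)))

theorem realize_conjFormula (X Y : Fin d → Matrix (Fin n) (Fin n) K) :
    (conjFormula n d).Realize (entryVal (Sum.elim X Y)) ↔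
      ∃ O : Matrix (Fin n) (Fin n) K, O * Oᵀ = 1 ∧ ∀ i, Oᵀ * X i * O = Y i := by
  have htr : ∀ (Z : (Fin d ⊕ Fin d) ⊕ Unit → Matrix (Fin n) (Fin n) K) a,
      (FreeCommRing.lift (entryVal Z)).mapMatrix (gen a)ᵀ = (Z a)ᵀ := fun Z a =>
    congrArg Matrix.transpose (mapMatrix_gen Z a)
  rw [conjFormula, realize_exMat]
  simp only [Formula.realize_inf, Formula.realize_iInf, realize_matEq, map_mul, map_one,
    mapMatrix_gen, htr, Sum.elim_inl, Sum.elim_inr]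
  exact ⟨fun ⟨W, h⟩ => ⟨W (), h⟩, fun ⟨O, h⟩ => ⟨fun _ => O, h⟩⟩

instance finite_words (d D : ℕ) : Finite {w : List (Fin d × Bool) // w.length ≤ D} :=
  (List.finite_length_le (Fin d × Bool) D).to_subtype

/-- The Specht property for tuples of length `d` and words of length at most `D`. -/
noncomputable def spechtSentence (n d D : ℕ) : Language.ring.Sentence :=
  Formula.iAlls ((Fin d ⊕ Fin d) × Fin n × Fin n) <| Formula.relabel Sum.inr <|
    Formula.imp (Formula.iInf fun w : {w : List (Fin d × Bool) // w.length ≤ D} =>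
      traceFormula n w.1) (conjFormula n d)

theorem realize_spechtSentence (d D : ℕ) :
    K ⊨ spechtSentence n d D ↔ SpechtFor K n d D := by
  rw [Sentence.Realize, spechtSentence, Formula.realize_iAlls]
  constructor
  · intro h X Y hXY
    have := h (entryVal (Sum.elim X Y))
    rw [Formula.realize_relabel, Sum.elim_comp_inr, Formula.realize_imp, Formula.realize_iInf,
      realize_conjFormula] at this
    exact this fun w => (realize_traceFormula w.1 X Y).2 (hXY w.1 w.2)
  · intro h v
    obtain ⟨X, Y, rfl⟩ : ∃ X Y : Fin d → Matrix (Fin n) (Fin n) K,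
        v = entryVal (Sum.elim X Y) :=
      ⟨fun i => ofEntryVal v (.inl i), fun i => ofEntryVal v (.inr i), by
        ext ⟨a | a, i, j⟩ <;> rfl⟩
    rw [Formula.realize_relabel, Sum.elim_comp_inr, Formula.realize_imp, Formula.realize_iInf,
      realize_conjFormula]
    exact fun hw => h X Y fun w hwl => (realize_traceFormula w X Y).1 (hw ⟨w, hwl⟩)

end Polynomial

end MatFormula

/-! ### Elementary equivalence -/

section Transfer

/-- The axioms of formally real Pythagorean fields. -/
def realPythagoreanSentence : Language.ring.Sentence :=
  (∀' ∀' ∃' ((&0 * &0 + &1 * &1) =' (&2 * &2))) ⊓ ∀' ∼ ((&0 * &0 + 1) =' 0)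

theorem realize_realPythagoreanSentence {K : Type*} [Field K] [CompatibleRing K] :
    K ⊨ realPythagoreanSentence ↔ IsRealPythagorean K := by
  have : K ⊨ realPythagoreanSentence ↔
      (∀ x y : K, ∃ z, x * x + y * y = z * z) ∧ ∀ x : K, x * x + 1 ≠ 0 := by
    simp [realPythagoreanSentence, Sentence.Realize, Formula.Realize, Fin.snoc]
  rw [this]
  exact ⟨fun h => ⟨h.1, h.2⟩, fun h => ⟨h.1, h.2⟩⟩

theorem HasQE.of_elementarilyEquivalent {L : FirstOrder.Language.{v, w}} {M N : Type*}
    [L.Structure M] [L.Structure N] (hMN : M ≅[L] N) (h : HasQE L M) : HasQE L N := by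
  intro k φ
  obtain ⟨ψ, hψ, hφψ⟩ := h k φ
  refine ⟨ψ, hψ, ?_⟩
  let θ : L.Sentence := Formula.iAlls (Fin k) (Formula.relabel Sum.inr (φ.iff ψ))
  have hθ : M ⊨ θ := by
    rw [Sentence.Realize, Formula.realize_iAlls]
    intro a
    rw [Formula.realize_relabel, Sum.elim_comp_inr, Formula.realize_iff]
    exact hφψ a
  have hθ' : N ⊨ θ := (elementarilyEquivalent_iff.1 hMN θ).1 hθ
  rw [Sentence.Realize, Formula.realize_iAlls] at hθ'
  intro a
  have := hθ' a
  rwa [Formula.realize_relabel, Sum.elim_comp_inr, Formula.realize_iff] at this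

variable {L : FirstOrder.Language.{v, w}}

theorem realize_ring_iff_of_elementarilyEquivalent {K K' : Type*} [Language.ring.Structure K]
    [L.Structure K] [Language.ring.Structure K'] [L.Structure K']
    (h : K ≅[fieldLang L] K') (φ : Language.ring.Sentence) : K ⊨ φ ↔ K' ⊨ φ := by
  have := elementarilyEquivalent_iff.1 h ((LHom.sumInl : Language.ring →ᴸ fieldLang L).onSentence φ)
  rwa [LHom.realize_onSentence, LHom.realize_onSentence] at this

variable {K : Type*} [Field K] [CompatibleRing K] [L.Structure K]

theorem IsRealPythagorean.of_elementarilyEquivalent {K' : Type*} [Field K'] [CompatibleRing K']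
    [L.Structure K'] (h : K ≅[fieldLang L] K') (hK : IsRealPythagorean K) :
    IsRealPythagorean K' := by
  rw [← realize_realPythagoreanSentence] at hK ⊢
  exact (realize_ring_iff_of_elementarilyEquivalent h _).1 hK

theorem SpechtFor.of_elementarilyEquivalent {K' : Type*} [Field K'] [CompatibleRing K']
    [L.Structure K'] (h : K ≅[fieldLang L] K') {n d D : ℕ} (hK : SpechtFor K n d D) :
    SpechtFor K' n d D := by
  rw [← MatFormula.realize_spechtSentence] at hK ⊢
  exact (realize_ring_iff_of_elementarilyEquivalent h _).1 hK

/-- A structure that is elementarily equivalent to an expanded field is an expanded field. -/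
theorem exists_field_of_elementarilyEquivalent {Ω : Type*} (S : (fieldLang L).Structure Ω)
    (h : K ≅[fieldLang L] Ω) :
    ∃ (_ : Field Ω) (_ : CompatibleRing Ω) (_ : L.Structure Ω),
      S = Language.sumStructure Language.ring L Ω := by
  let S₁ : Language.ring.Structure Ω := (LHom.sumInl : Language.ring →ᴸ fieldLang L).reduct Ω
  let S₂ : L.Structure Ω := (LHom.sumInr : L →ᴸ fieldLang L).reduct Ω
  have hS : S = Language.sumStructure Language.ring L Ω := by
    ext m f x
    · rcases f with f | f <;> rfl
    · rcases f with f | f <;> rfl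
  rw [hS] at h
  have : Theory.field.Model Ω := ⟨fun φ hφ =>
    (realize_ring_iff_of_elementarilyEquivalent h φ).1 (Theory.realize_sentence_of_mem _ hφ)⟩
  let := FirstOrder.Field.fieldOfModelField Ω
  let := FirstOrder.Field.compatibleRingOfModelField Ω
  exact ⟨_, FirstOrder.Field.compatibleRingOfModelField Ω, S₂, hS⟩

end Transfer

/-! ### Ultrapowers and amalgamation -/

section Ultrapower

variable {L : FirstOrder.Language.{v, w}}

theorem exists_ultrapower (M : Type u) [L.Structure M] [Nonempty M] {I : Type x}
    (U : Ultrafilter I) :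
    ∃ (N : Type (max u x)) (_ : L.Structure N) (mk : (I → M) → N),
      ∀ {β : Type} (φ : L.Formula β) (a : β → I → M),
        φ.Realize (fun b => mk (a b)) ↔ ∀ᶠ i in U, φ.Realize fun b => a b i :=
  ⟨(U : Filter I).Product fun _ => M, inferInstance, fun a => a,
    fun φ a => Ultraproduct.realize_formula_cast φ a⟩

theorem exists_field_ultrapower (K : Type u) [Field K] [CompatibleRing K] [L.Structure K]
    {I : Type x} (U : Ultrafilter I) :
    ∃ (N : Type (max u x)) (_ : Field N) (_ : CompatibleRing N) (_ : L.Structure N)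
      (mk : (I → K) → N), (K ≅[fieldLang L] N) ∧
      ∀ {β : Type} (φ : (fieldLang L).Formula β) (a : β → I → K),
        φ.Realize (fun b => mk (a b)) ↔ ∀ᶠ i in U, φ.Realize fun b => a b i := by
  obtain ⟨N, S, mk, hmk⟩ := exists_ultrapower (L := fieldLang L) K U
  have hKN : K ≅[fieldLang L] N := by
    rw [elementarilyEquivalent_iff]
    intro φ
    have := hmk φ default
    rw [Sentence.Realize, Sentence.Realize, Subsingleton.elim (default : Empty → N) _, this,
      Filter.eventually_congr (.of_forall fun i => by
        rw [Subsingleton.elim (fun b => (default : Empty → I → K) b i) default])]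
    simp
  obtain ⟨_, _, _, hS⟩ := exists_field_of_elementarilyEquivalent S hKN
  subst hS
  exact ⟨N, _, _, _, mk, hKN, hmk⟩

/-- Elements of `M` serve as variables naming themselves. Quantifying away the free variables
outside `s` leaves a formula true at elements of `s`, which `ρ` preserves; witnesses for the
transferred formula define `f` off `s`. -/
theorem exists_extension_realize {M : Type u} [L.Structure M] {s : Set M} {ρ : s → M}
    (hρ : ∀ (k : ℕ) (φ : L.Formula (Fin k)) (a : Fin k → s),
      φ.Realize (fun i => (a i : M)) → φ.Realize fun i => ρ (a i))
    (φ : L.Formula M) (hφ : φ.Realize id) :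
    ∃ f : M → M, (∀ a : s, f a = ρ a) ∧ φ.Realize f := by
  classical
  let p : φ.freeVarFinset → Prop := fun a => (a : M) ∈ s
  let φ' : L.Formula φ.freeVarFinset := φ.restrictFreeVar id
  have hφ' : ∀ {f : M → M} {g : φ.freeVarFinset → M}, (∀ a, g a = f a) →
      (φ'.Realize g ↔ φ.Realize f) := fun {f g} h =>
    BoundedFormula.realize_restrictFreeVar f h
  let e : φ.freeVarFinset ≃ {a // p a} ⊕ {a // ¬ p a} := (Equiv.sumCompl p).symm
  let θ : L.Formula {a // p a} := (φ'.relabel e).iExs {a // ¬ p a}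
  obtain ⟨k, ⟨e₁⟩⟩ := Finite.exists_equiv_fin {a // p a}
  have h1 : θ.Realize fun a => (a.1 : M) := by
    rw [Formula.realize_iExs]
    refine ⟨fun a => a.1, ?_⟩
    rw [Formula.realize_relabel, hφ' (f := id)]
    · exact hφ
    · intro a
      by_cases ha : p a
      · simp [e, Equiv.sumCompl_symm_apply_of_pos ha]
      · simp [e, Equiv.sumCompl_symm_apply_of_neg ha]
  have h2 := hρ k (θ.relabel e₁) (fun i => ⟨(e₁.symm i).1, (e₁.symm i).2⟩)
    (by rw [Formula.realize_relabel]; simpa [Function.comp_def] using h1)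
  rw [Formula.realize_relabel, Formula.realize_iExs] at h2
  obtain ⟨g, hg⟩ := h2
  let f : M → M := fun a => if h : a ∈ s then ρ ⟨a, h⟩ else
    if h' : a ∈ φ.freeVarFinset then g ⟨⟨a, h'⟩, h⟩ else a
  refine ⟨f, fun a => by simp [f], ?_⟩
  rw [Formula.realize_relabel, hφ' (f := f)] at hg
  · exact hg
  · intro a
    by_cases ha : p a
    · have ha' : (a : M) ∈ s := ha
      simp [e, Equiv.sumCompl_symm_apply_of_pos ha, f, ha']
    · have ha' : (a : M) ∉ s := ha
      simp [e, Equiv.sumCompl_symm_apply_of_neg ha, f, ha']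

/-- Elementary amalgamation over a partial elementary map. -/
theorem exists_elementary_amalgam {M : Type u} [L.Structure M] [Nonempty M] {s : Set M}
    {ρ : s → M}
    (hρ : ∀ (k : ℕ) (φ : L.Formula (Fin k)) (a : Fin k → s),
      φ.Realize (fun i => (a i : M)) → φ.Realize fun i => ρ (a i)) :
    ∃ (N : Type (max u v w)) (_ : L.Structure N) (j σ : M ↪ₑ[L] N),
      ∀ a : s, σ a = j (ρ a) := by
  classical
  -- Each finite part `i` of the elementary diagram of `M` is realized by an extension `f i` of `ρ`.
  -- In the ultrapower over all finite parts, the maps `f i` glue to `σ`, while `j` is the diagonal.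
  have hf : ∀ i : Finset (L.Formula M), ∃ f : M → M, (∀ a : s, f a = ρ a) ∧
      ∀ φ ∈ i, φ.Realize id → φ.Realize f := by
    intro i
    obtain ⟨f, hfs, hf⟩ := exists_extension_realize hρ
      (Formula.iInf fun φ : {φ : i // φ.1.Realize id} => φ.1.1)
      (Formula.realize_iInf.2 fun φ => φ.2)
    exact ⟨f, hfs, fun φ hφ hr => Formula.realize_iInf.1 hf ⟨⟨φ, hφ⟩, hr⟩⟩
  choose f hfs hf using hf
  let U : Ultrafilter (Finset (L.Formula M)) := Ultrafilter.of Filter.atTop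
  obtain ⟨N, S, mk, hmk⟩ := exists_ultrapower (L := L) M U
  have hσ : ∀ {k : ℕ} (φ : L.Formula (Fin k)) (a : Fin k → M), φ.Realize a →
      ∀ᶠ i in U, φ.Realize fun b => f i (a b) := by
    intro k φ a ha
    have h1 : ∀ᶠ i in U, ({φ.relabel a} : Finset (L.Formula M)) ⊆ i :=
      (Filter.eventually_ge_atTop ({φ.relabel a} : Finset (L.Formula M))).filter_mono
        (Ultrafilter.of_le _)
    filter_upwards [h1] with i hi
    have := hf i _ (Finset.singleton_subset_iff.1 hi)
      (by rw [Formula.realize_relabel]; exact ha)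
    rwa [Formula.realize_relabel] at this
  refine ⟨N, S, ⟨fun a => mk fun _ => a, fun k φ a => ?_⟩,
    ⟨fun a => mk fun i => f i a, fun k φ a => ?_⟩, fun a => ?_⟩
  · refine (hmk φ fun b _ => a b).trans ?_
    simp
  · refine (hmk φ fun b i => f i (a b)).trans ⟨fun h => ?_, hσ φ a⟩
    -- The converse direction is preservation of the negated formula.
    by_contra hn
    have h' := hσ φ.not a hn
    obtain ⟨i, hi, hi'⟩ := (h.and h').exists
    exact hi' hi
  · exact congrArg mk (funext fun i => hfs i a)

end Ultrapower

/-! ### From extension of embeddings to the Specht property -/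

namespace MatLang

open Structure MatFormula

variable {L : FirstOrder.Language.{v, w}} {n d : ℕ}

theorem realize_conjFormula_iff {K : Type*} [Field K] [CompatibleRing K] [L.Structure K]
    (X Y : Fin d → Matrix (Fin n) (Fin n) K) :
    ((LHom.sumInl : Language.ring →ᴸ fieldLang L).onFormula (conjFormula n d)).Realize
        (entryVal (Sum.elim X Y)) ↔
      ∃ O : Matrix (Fin n) (Fin n) K, O * Oᵀ = 1 ∧ ∀ i, Oᵀ * X i * O = Y i := by
  rw [LHom.realize_onFormula, realize_conjFormula]

theorem realize_traceFormula_iff {K : Type*} [Field K] [CompatibleRing K] [L.Structure K]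
    (w : List (Fin d × Bool)) (X Y : Fin d → Matrix (Fin n) (Fin n) K) :
    ((LHom.sumInl : Language.ring →ᴸ fieldLang L).onFormula (traceFormula n w)).Realize
        (entryVal (Sum.elim X Y)) ↔ (wordEval X w).trace = (wordEval Y w).trace := by
  rw [LHom.realize_onFormula, realize_traceFormula]

/-- Tuples with the same traces of all words generate isomorphic structures. -/
theorem exists_embedding_of_tracesAgree {K : Type*} [Field K] [L.Structure K]
    (hK : IsRealPythagorean K) (hn : 0 < n) {X Y : Fin d → Matrix (Fin n) (Fin n) K}
    (h : ∀ D, TracesAgree X Y D) :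
    ∃ (U : (matLang L).Substructure (Matrix (Fin n) (Fin n) K))
      (ψ : U ↪[matLang L] Matrix (Fin n) (Fin n) K),
      ∀ A B m, (A, B) ∈ wordSpan X Y m → ∃ hA : A ∈ U, ψ ⟨A, hA⟩ = B := by
  -- One direction makes the map well defined, the other makes it injective.
  have huniq : ∀ {A A' B B' m m'}, (A, B) ∈ wordSpan X Y m → (A', B') ∈ wordSpan X Y m' →
      (A = A' ↔ B = B') := fun {A A' B B' m m'} hm hm' =>
    (h (max m m' + max m m')).eq_iff hK (wordSpan_mono (le_max_left _ _) hm)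
      (wordSpan_mono (le_max_right _ _) hm')
  have hfun : ∀ {k : ℕ} (f : (matLang L).Functions k) (A B : Fin k → Matrix (Fin n) (Fin n) K)
      (m : Fin k → ℕ), (∀ i, (A i, B i) ∈ wordSpan X Y (m i)) →
      ∃ m, (funMap f A, funMap f B) ∈ wordSpan X Y m := by
    intro k f A B m hm
    exact ⟨_, funMap_mem_wordSpan hK hn (h _) f fun i =>
      wordSpan_mono (Finset.le_sup (f := m) (Finset.mem_univ i)) (hm i)⟩
  -- The span is over `K`, so `U` contains the whole center, and the embedding will fix it.
  let U : (matLang L).Substructure (Matrix (Fin n) (Fin n) K) :=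
    { carrier := {A | ∃ B m, (A, B) ∈ wordSpan X Y m}
      fun_mem := by
        intro k f A hA
        choose B m hm using hA
        obtain ⟨m', hm'⟩ := hfun f A B m hm
        exact ⟨_, m', hm'⟩ }
  choose g m hg using fun A : U => A.2
  refine ⟨U, ⟨⟨g, fun A A' hAA' => ?_⟩, fun f A => ?_, fun r A => ?_⟩, fun A B k hAB => ?_⟩
  · exact Subtype.ext ((huniq (hg A) (hg A')).2 hAA')
  · obtain ⟨m', hm'⟩ := hfun f (fun i => (A i : Matrix (Fin n) (Fin n) K)) (fun i => g (A i)) _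
      fun i => hg (A i)
    exact (huniq (hg _) hm').1 rfl
  · exact (relMap_iff_of_mem_wordSpan hK (h _) r fun i =>
      wordSpan_mono (Finset.le_sup (f := fun i => m (A i)) (Finset.mem_univ i)) (hg (A i))).symm
  · exact ⟨⟨B, k, hAB⟩, (huniq (hg ⟨A, B, k, hAB⟩) hAB).1 rfl⟩

section Embedding

variable {K Ω : Type*} [Field K] [Field Ω] [L.Structure K] [L.Structure Ω]
  (g : Matrix (Fin n) (Fin n) K ↪[matLang L] Matrix (Fin n) (Fin n) Ω)

theorem embedding_map_add (A B : Matrix (Fin n) (Fin n) K) : g (A + B) = g A + g B := by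
  simpa using g.map_fun (ringFun addFunc) ![A, B]

theorem embedding_map_mul (A B : Matrix (Fin n) (Fin n) K) : g (A * B) = g A * g B := by
  simpa using g.map_fun (ringFun mulFunc) ![A, B]

theorem embedding_map_zero : g 0 = 0 := by
  simpa using g.map_fun (ringFun zeroFunc) ![]

theorem embedding_map_transpose (A : Matrix (Fin n) (Fin n) K) : g Aᵀ = (g A)ᵀ := by
  simpa using g.map_fun invFun ![A]

theorem embedding_map_sum {ι : Type*} (s : Finset ι) (A : ι → Matrix (Fin n) (Fin n) K) :
    g (∑ i ∈ s, A i) = ∑ i ∈ s, g (A i) :=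
  map_sum (⟨⟨g, embedding_map_zero g⟩, embedding_map_add g⟩ :
    Matrix (Fin n) (Fin n) K →+ Matrix (Fin n) (Fin n) Ω) A s

/-- An embedding of matrix structures that extends a map `j` of the centers is the entrywise
application of `j`, up to conjugation. -/
theorem exists_orthogonal_of_embedding (hΩ : IsRealPythagorean Ω) (hn : 0 < n) (j : K → Ω)
    (hj : ∀ a, g (Matrix.scalar (Fin n) a) = Matrix.scalar (Fin n) (j a)) :
    ∃ O : Matrix (Fin n) (Fin n) Ω, O * Oᵀ = 1 ∧ ∀ X, Oᵀ * X.map j * O = g X := by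
  let i₀ : Fin n := ⟨0, hn⟩
  obtain ⟨O, hO, hconj⟩ := hΩ.exists_orthogonal_of_column i₀
    -- The relations between the standard units use only multiplication, transposition and zero, so
    -- `g` preserves them.
    (fun i => g (Matrix.single i i₀ 1))
    (by
      intro i j
      rw [← embedding_map_transpose, ← embedding_map_mul, single_column_transpose_mul]
      split_ifs
      · rfl
      · exact embedding_map_zero g)
    (by
      rw [← embedding_map_zero g, g.injective.ne_iff]
      intro h0
      simpa using congrFun (congrFun h0 i₀) i₀)
  refine ⟨Oᵀ, by rw [Matrix.transpose_transpose]; exact mul_eq_one_comm.mp hO, fun X => ?_⟩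
  have h := hconj (X.map j) (g X) fun i => by
    rw [← embedding_map_mul, mul_single_column, embedding_map_sum]
    refine Finset.sum_congr rfl fun k _ => ?_
    rw [Matrix.smul_eq_diagonal_mul, ← Matrix.scalar_apply, embedding_map_mul, hj,
      Matrix.map_apply, Matrix.smul_eq_diagonal_mul, ← Matrix.scalar_apply]
  rw [Matrix.transpose_transpose, ← h]
  simp only [← Matrix.mul_assoc, hO, Matrix.one_mul]
  rw [Matrix.mul_assoc, hO, Matrix.mul_one]

end Embedding

theorem spechtProperty_of_embeddingsExtend {F : Type u} [Field F] [CompatibleRing F]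
    [L.Structure F] (hF : IsRealPythagorean F) (hn : 0 < n)
    (h : EmbeddingsExtend.{u, v, w, x} L F n) : SpechtProperty F n := by
  rw [spechtProperty_iff]
  by_contra! hno
  simp only [SpechtFor, not_forall] at hno
  choose X Y hXY hno using hno
  -- The index is the bound `D`. Since the ultrafilter refines `atTop`, the traces of each fixed
  -- word agree in the ultrapower.
  let U : Ultrafilter (ULift.{x} ℕ) := Ultrafilter.of (Filter.map ULift.up Filter.atTop)
  obtain ⟨K, _, _, _, mk, hFK, hmk⟩ := exists_field_ultrapower (L := L) F U
  have hK := hF.of_elementarilyEquivalent hFK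
  let X' : Fin (tupleBound n) → Matrix (Fin n) (Fin n) K :=
    fun k => Matrix.of fun i j => mk fun D => X D.down k i j
  let Y' : Fin (tupleBound n) → Matrix (Fin n) (Fin n) K :=
    fun k => Matrix.of fun i j => mk fun D => Y D.down k i j
  have hentry : entryVal (Sum.elim X' Y') =
      fun b => mk fun D => entryVal (Sum.elim (X D.down) (Y D.down)) b := by
    ext ⟨a | a, i, j⟩ <;> rfl
  have htraces : ∀ D, TracesAgree X' Y' D := by
    intro D w _
    rw [← realize_traceFormula_iff (L := L), hentry, hmk]
    have : ∀ᶠ D : ULift.{x} ℕ in Filter.map ULift.up Filter.atTop, w.length ≤ D.down :=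
      Filter.eventually_map.2 (Filter.eventually_ge_atTop w.length)
    filter_upwards [this.filter_mono (Ultrafilter.of_le _)] with D hD
    exact (realize_traceFormula_iff (L := L) _ _ _).2 (hXY _ w hD)
  obtain ⟨V, ψ, hψ⟩ := exists_embedding_of_tracesAgree (L := L) hK hn htraces
  obtain ⟨Ω, _, _, _, j, g, hg⟩ := h K hFK V ψ
  have hΩ : IsRealPythagorean Ω := hK.of_elementarilyEquivalent j.elementarilyEquivalent
  have hg' : ∀ A B m, (A, B) ∈ wordSpan X' Y' m → g A = B.map j := by
    intro A B m hAB
    obtain ⟨hA, rfl⟩ := hψ A B m hAB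
    exact hg ⟨A, hA⟩
  have hj0 : j 0 = 0 := map_zero (embeddingRingHom j.toEmbedding)
  -- As `ψ` fixes scalars, its extension `g` acts on the center through `j`.
  obtain ⟨O, hO, hOX⟩ := exists_orthogonal_of_embedding g hΩ hn j fun a => by
    rw [hg' _ _ 0 (scalar_mem_wordSpan a), Matrix.scalar_apply, Matrix.diagonal_map hj0]
    rfl
  have hconj := (realize_conjFormula_iff (L := L) (fun i => (X' i).map j)
    fun i => (Y' i).map j).2
      ⟨O, hO, fun i => (hOX (X' i)).trans (hg' _ _ 1 (letter_mem_wordSpan i le_rfl))⟩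
  have hentry' : entryVal (Sum.elim (fun i => (X' i).map j) fun i => (Y' i).map j) =
      j ∘ entryVal (Sum.elim X' Y') := by
    ext ⟨a | a, i, k⟩ <;> rfl
  -- Conjugacy over `Ω` descends to `K` by elementarity, then to the tuples for some `D` by Łoś.
  rw [hentry', j.map_formula, hentry, hmk] at hconj
  obtain ⟨D, hD⟩ := hconj.exists
  exact hno _ ((realize_conjFormula_iff _ _).1 hD)

end MatLang

/-! ### The Specht property implies that embeddings extend -/

namespace MatLang

open Structure MatFormula

variable {L : FirstOrder.Language.{v, w}} {n d : ℕ}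

section Substructure

variable {K : Type*} [Field K] [L.Structure K]
  {U : (matLang L).Substructure (Matrix (Fin n) (Fin n) K)}
  (ψ : U ↪[matLang L] Matrix (Fin n) (Fin n) K)

theorem exists_add (A B : U) :
    ∃ C : U, (C : Matrix (Fin n) (Fin n) K) = A + B ∧ ψ C = ψ A + ψ B :=
  ⟨funMap (ringFun addFunc) ![A, B], rfl, ψ.map_fun (ringFun addFunc) ![A, B]⟩

theorem exists_mul (A B : U) :
    ∃ C : U, (C : Matrix (Fin n) (Fin n) K) = A * B ∧ ψ C = ψ A * ψ B :=
  ⟨funMap (ringFun mulFunc) ![A, B], rfl, ψ.map_fun (ringFun mulFunc) ![A, B]⟩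

theorem exists_zero : ∃ C : U, (C : Matrix (Fin n) (Fin n) K) = 0 ∧ ψ C = 0 :=
  ⟨funMap (ringFun zeroFunc) ![], rfl, ψ.map_fun (ringFun zeroFunc) ![]⟩

theorem exists_one : ∃ C : U, (C : Matrix (Fin n) (Fin n) K) = 1 ∧ ψ C = 1 :=
  ⟨funMap (ringFun oneFunc) ![], rfl, ψ.map_fun (ringFun oneFunc) ![]⟩

theorem exists_transpose (A : U) :
    ∃ C : U, (C : Matrix (Fin n) (Fin n) K) = (A : Matrix (Fin n) (Fin n) K)ᵀ ∧ ψ C = (ψ A)ᵀ :=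
  ⟨funMap invFun ![A], rfl, ψ.map_fun invFun ![A]⟩

theorem exists_trace (A : U) :
    ∃ C : U, (C : Matrix (Fin n) (Fin n) K) =
        Matrix.scalar (Fin n) (A : Matrix (Fin n) (Fin n) K).trace ∧
      ψ C = Matrix.scalar (Fin n) (ψ A).trace :=
  ⟨funMap trFun ![A], rfl, ψ.map_fun trFun ![A]⟩

theorem exists_wordEval (A : Fin d → U) (w : List (Fin d × Bool)) :
    ∃ C : U, (C : Matrix (Fin n) (Fin n) K) =
        wordEval (fun i => (A i : Matrix (Fin n) (Fin n) K)) w ∧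
      ψ C = wordEval (fun i => ψ (A i)) w := by
  induction w with
  | nil => exact exists_one ψ
  | cons p w ih =>
    obtain ⟨C, hC, hψC⟩ := ih
    obtain ⟨B, hB, hψB⟩ : ∃ B : U, (B : Matrix (Fin n) (Fin n) K) =
        (if p.2 then (A p.1 : Matrix (Fin n) (Fin n) K)ᵀ else A p.1) ∧
          ψ B = if p.2 then (ψ (A p.1))ᵀ else ψ (A p.1) := by
      split_ifs
      · exact exists_transpose ψ _
      · exact ⟨_, rfl, rfl⟩
    obtain ⟨E, hE, hψE⟩ := exists_mul ψ B C
    exact ⟨E, by rw [hE, hB, hC, wordEval_cons], by rw [hψE, hψB, hψC, wordEval_cons]⟩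

/-- A scalar matrix satisfies `n • C = tr(C)`, an equation that `ψ` preserves; dividing by `n` shows
that the image is scalar. -/
theorem exists_map_scalar (hK : IsRealPythagorean K) (hn : 0 < n) (C : U) (a : K)
    (hC : (C : Matrix (Fin n) (Fin n) K) = Matrix.scalar (Fin n) a) :
    ∃ b, ψ C = Matrix.scalar (Fin n) b := by
  have hnsmul : ∀ k : ℕ, ∃ E : U, (E : Matrix (Fin n) (Fin n) K) =
      k • (C : Matrix (Fin n) (Fin n) K) ∧ ψ E = k • ψ C := by
    intro k
    induction k with
    | zero => simpa using exists_zero ψ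
    | succ k ih =>
      obtain ⟨E, hE, hψE⟩ := ih
      obtain ⟨E', hE', hψE'⟩ := exists_add ψ E C
      exact ⟨E', by rw [hE', hE, succ_nsmul], by rw [hψE', hψE, succ_nsmul]⟩
  obtain ⟨E, hE, hψE⟩ := hnsmul n
  obtain ⟨T, hT, hψT⟩ := exists_trace ψ C
  have hET : E = T := by
    apply Subtype.ext
    rw [hE, hT, hC]
    ext i j
    by_cases h : i = j <;> simp [h, Matrix.trace]
  rw [← hET, hψE] at hψT
  refine ⟨(n : K)⁻¹ * (ψ C).trace, ?_⟩
  have hn0 := hK.natCast_ne_zero hn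
  rw [map_mul, ← hψT, Matrix.scalar_apply, ← Matrix.smul_eq_diagonal_mul,
    ← Nat.cast_smul_eq_nsmul K, smul_smul, inv_mul_cancel₀ hn0, one_smul]

/-- The restriction of an embedding to the center is a partial elementary map. -/
theorem exists_partial_elementary [CompatibleRing K] (hK : IsRealPythagorean K)
    (hQE : HasQE (fieldLang L) K) (hn : 0 < n) :
    ∃ ρ : {a : K | Matrix.scalar (Fin n) a ∈ U} → K,
      (∀ a, ψ ⟨Matrix.scalar (Fin n) a.1, a.2⟩ = Matrix.scalar (Fin n) (ρ a)) ∧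
      ∀ (k : ℕ) (φ : (fieldLang L).Formula (Fin k))
        (a : Fin k → {a : K | Matrix.scalar (Fin n) a ∈ U}),
        φ.Realize (fun i => (a i : K)) → φ.Realize fun i => ρ (a i) := by
  choose ρ hρ using fun a : {a : K | Matrix.scalar (Fin n) a ∈ U} =>
    exists_map_scalar ψ hK hn ⟨Matrix.scalar (Fin n) a.1, a.2⟩ a.1 rfl
  refine ⟨ρ, hρ, fun k φ a ha => ?_⟩
  -- Quantifier elimination in the field replaces `φ` by a formula whose truth on scalar matrices is
  -- preserved by the inclusion of `U` and by `ψ`.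
  obtain ⟨θ, hθ, hφθ⟩ := hQE k φ
  rw [hφθ] at ha ⊢
  rw [← realize_onFormula_scalar hn hθ] at ha ⊢
  have hθ' : BoundedFormula.IsQF (ofField.onFormula θ) := isQF_onBoundedFormula ofField hθ
  let c : Fin k → U := fun i => ⟨Matrix.scalar (Fin n) (a i).1, (a i).2⟩
  have h1 := (hθ'.realize_embedding U.subtype (v := c) (xs := default))
  have h2 := (hθ'.realize_embedding ψ (v := c) (xs := default))
  rw [Subsingleton.elim (_ ∘ default) default] at h1 h2
  have h3 : (ψ ∘ c) = fun i => Matrix.scalar (Fin n) (ρ (a i)) := funext fun i => hρ (a i)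
  rw [h3] at h2
  exact h2.2 (h1.1 ha)

end Substructure

theorem embeddingsExtend_of_spechtProperty {F : Type u} [Field F] [CompatibleRing F]
    [L.Structure F] (hF : IsRealPythagorean F) (hQE : HasQE (fieldLang L) F) (hn : 0 < n)
    (h : SpechtProperty F n) : EmbeddingsExtend.{u, v, w, x} L F n := by
  intro K _ _ _ hFK U ψ
  obtain ⟨D, hD⟩ := h
  have hK := hF.of_elementarilyEquivalent hFK
  obtain ⟨ρ, hψρ, hρ⟩ :=
    exists_partial_elementary ψ hK (hQE.of_elementarilyEquivalent hFK) hn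
  -- `ψ` may move scalars. In `Ω` this is absorbed by comparing `σ` of the source with `j` of the
  -- target.
  obtain ⟨Ω, S, j, σ, hσ⟩ := exists_elementary_amalgam hρ
  obtain ⟨_, _, _, hS⟩ := exists_field_of_elementarilyEquivalent S j.elementarilyEquivalent
  subst hS
  have hΩ : SpechtFor Ω n (tupleBound n) D := SpechtFor.of_elementarilyEquivalent
    (hFK.trans j.elementarilyEquivalent) (hD (tupleBound n))
  have : Nonempty U := ⟨(exists_one ψ).choose⟩
  obtain ⟨e, he⟩ := exists_spanning_tuple fun A : U =>
    ((A : Matrix (Fin n) (Fin n) K).map σ, (ψ A).map j)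
  have hword : ∀ (τ : K ↪ₑ[fieldLang L] Ω) (X : Fin (tupleBound n) → Matrix (Fin n) (Fin n) K)
      (w : List (Fin (tupleBound n) × Bool)),
      (wordEval (fun i => (X i).map τ) w).trace = τ (wordEval X w).trace := by
    intro τ X w
    have h1 := mapMatrix_ringWordEval (embeddingRingHom τ.toEmbedding) X w
    refine (congrArg Matrix.trace h1.symm).trans ?_
    exact (AddMonoidHom.map_trace (embeddingRingHom τ.toEmbedding) (wordEval X w)).symm
  obtain ⟨O, hO, hconj⟩ := hΩ (fun i => (e i : Matrix (Fin n) (Fin n) K).map σ)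
    (fun i => (ψ (e i)).map j) (by
      intro w _
      rw [hword, hword]
      obtain ⟨C, hC, hψC⟩ := exists_wordEval ψ e w
      obtain ⟨T, hT, hψT⟩ := exists_trace ψ C
      rw [← hC, ← hψC]
      -- The trace symbol puts the trace of `C`, as a scalar matrix, into `U`, where `σ = j ∘ ρ`
      -- applies.
      have hmem : (C : Matrix (Fin n) (Fin n) K).trace ∈
          {a : K | Matrix.scalar (Fin n) a ∈ U} := by
        rw [Set.mem_ofPred_eq, ← hT]
        exact T.2
      rw [hσ ⟨_, hmem⟩]
      congr 1
      rw [← scalar_inj hn, ← hψρ, ← hψT]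
      exact congrArg ψ (Subtype.ext hT.symm))
  obtain ⟨g, hg⟩ := exists_embedding_of_conj hn σ.toEmbedding O hO
  refine ⟨Ω, _, _, _, j, g, fun A => ?_⟩
  rw [hg]
  have hle : Submodule.span Ω (Set.range ((fun A : U =>
      ((A : Matrix (Fin n) (Fin n) K).map σ, (ψ A).map j)) ∘ e)) ≤ conjPairs O := by
    rw [Submodule.span_le]
    rintro _ ⟨k, rfl⟩
    exact hconj k
  exact hle (he A)

end MatLang

/-! ### Matrix formulas as formulas in the entries -/

namespace MatLang

open Structure MatFormula

variable {L : FirstOrder.Language.{v, w}} {n d : ℕ} {K : Type*} [Field K] [CompatibleRing K]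
  [L.Structure K] {α β γ : Type*}

/-- The property `P` of families of matrices is given by a formula in the entries. -/
def EntryDefinable (L : FirstOrder.Language.{v, w}) [L.Structure K]
    (P : (α → Matrix (Fin n) (Fin n) K) → Prop) : Prop :=
  ∃ φ : (fieldLang L).Formula (α × Fin n × Fin n), ∀ X, P X ↔ φ.Realize (entryVal X)

namespace EntryDefinable

variable {P Q : (α → Matrix (Fin n) (Fin n) K) → Prop}

theorem congr (h : EntryDefinable L P) (hPQ : ∀ X, Q X ↔ P X) : EntryDefinable L Q :=
  ⟨h.choose, fun X => (hPQ X).trans (h.choose_spec X)⟩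

theorem of_false : EntryDefinable L fun _ : α → Matrix (Fin n) (Fin n) K => False :=
  ⟨⊥, fun _ => Iff.rfl⟩

theorem imp (hP : EntryDefinable L P) (hQ : EntryDefinable L Q) :
    EntryDefinable L fun X => P X → Q X := by
  obtain ⟨φ, hφ⟩ := hP
  obtain ⟨ψ, hψ⟩ := hQ
  exact ⟨φ.imp ψ, fun X =>
    (imp_congr (hφ X) (hψ X)).trans Formula.realize_imp.symm⟩

theorem not (hP : EntryDefinable L P) : EntryDefinable L fun X => ¬ P X :=
  hP.imp of_false

theorem and (hP : EntryDefinable L P) (hQ : EntryDefinable L Q) :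
    EntryDefinable L fun X => P X ∧ Q X :=
  (hP.imp hQ.not).not.congr fun X => by tauto

theorem or (hP : EntryDefinable L P) (hQ : EntryDefinable L Q) :
    EntryDefinable L fun X => P X ∨ Q X :=
  (hP.not.imp hQ).congr fun X => by tauto

theorem forall_finite {ι : Type*} [Finite ι] {P : ι → (α → Matrix (Fin n) (Fin n) K) → Prop}
    (h : ∀ i, EntryDefinable L (P i)) : EntryDefinable L fun X => ∀ i, P i X := by
  choose φ hφ using h
  exact ⟨Formula.iInf φ, fun X => by simp only [Formula.realize_iInf, hφ]⟩

theorem relabel (hP : EntryDefinable L P) (r : α → β) :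
    EntryDefinable L fun X : β → Matrix (Fin n) (Fin n) K => P fun a => X (r a) := by
  obtain ⟨φ, hφ⟩ := hP
  exact ⟨φ.relabel (Prod.map r id), fun X => by
    rw [Formula.realize_relabel]
    exact hφ _⟩

theorem exists_family [Finite γ] {P : (α ⊕ γ → Matrix (Fin n) (Fin n) K) → Prop}
    (hP : EntryDefinable L P) :
    EntryDefinable L fun X => ∃ W : γ → Matrix (Fin n) (Fin n) K, P (Sum.elim X W) := by
  obtain ⟨φ, hφ⟩ := hP
  exact ⟨exMat φ, fun X => by simp only [realize_exMat, hφ]⟩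

theorem forall_family [Finite γ] {P : (α ⊕ γ → Matrix (Fin n) (Fin n) K) → Prop}
    (hP : EntryDefinable L P) :
    EntryDefinable L fun X => ∀ W : γ → Matrix (Fin n) (Fin n) K, P (Sum.elim X W) :=
  hP.not.exists_family.not.congr fun X => by simp

theorem of_matEq (A B : Matrix (Fin n) (Fin n) (FreeCommRing (α × Fin n × Fin n))) :
    EntryDefinable L fun X : α → Matrix (Fin n) (Fin n) K =>
      (FreeCommRing.lift (entryVal X)).mapMatrix A =
        (FreeCommRing.lift (entryVal X)).mapMatrix B :=
  ⟨(LHom.sumInl : Language.ring →ᴸ fieldLang L).onFormula (matEq A B), fun X => by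
    rw [LHom.realize_onFormula, realize_matEq]⟩

end EntryDefinable

open EntryDefinable

theorem entryDefinable_central (i₀ : Fin n) (a : α) :
    EntryDefinable L fun X : α → Matrix (Fin n) (Fin n) K =>
      X a = Matrix.scalar (Fin n) (X a i₀ i₀) := by
  refine (of_matEq (gen a) (Matrix.scalar (Fin n) (gen a i₀ i₀))).congr fun X => ?_
  have : (FreeCommRing.lift (entryVal X)).mapMatrix (Matrix.scalar (Fin n) (gen a i₀ i₀)) =
      Matrix.scalar (Fin n) (X a i₀ i₀) := by
    ext i j
    by_cases h : i = j <;> simp [h, gen, entryVal]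
  rw [mapMatrix_gen, this]

/-- The graph is described, not the value: the entries of a new function's value are given by a case
distinction on centrality. -/
theorem entryDefinable_funMap (hn : 0 < n) {k : ℕ} (f : (matLang L).Functions k) :
    EntryDefinable L fun X : Fin k ⊕ Unit → Matrix (Fin n) (Fin n) K =>
      X (Sum.inr ()) = funMap f fun i => X (Sum.inl i) := by
  have i₀ : Fin n := ⟨0, hn⟩
  induction f using forall_functions with
  | hadd =>
    refine (of_matEq (gen (Sum.inr ())) (gen (Sum.inl 0) + gen (Sum.inl 1))).congr fun X => ?_
    simp only [map_add, mapMatrix_gen, funMap_add]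
  | hmul =>
    refine (of_matEq (gen (Sum.inr ())) (gen (Sum.inl 0) * gen (Sum.inl 1))).congr fun X => ?_
    simp only [map_mul, mapMatrix_gen, funMap_mul]
  | hneg =>
    refine (of_matEq (gen (Sum.inr ())) (-gen (Sum.inl 0))).congr fun X => ?_
    simp only [map_neg, mapMatrix_gen, funMap_neg]
  | hzero =>
    refine (of_matEq (gen (Sum.inr ())) 0).congr fun X => ?_
    simp only [map_zero, mapMatrix_gen, funMap_zero]
  | hone =>
    refine (of_matEq (gen (Sum.inr ())) 1).congr fun X => ?_
    simp only [map_one, mapMatrix_gen, funMap_one]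
  | hnew k f =>
    have hcentral : EntryDefinable L fun X : Fin k ⊕ Unit → Matrix (Fin n) (Fin n) K =>
        ∀ i, X (Sum.inl i) = Matrix.scalar (Fin n) (X (Sum.inl i) i₀ i₀) :=
      forall_finite fun i => entryDefinable_central i₀ (Sum.inl i)
    have hval : EntryDefinable L fun X : Fin k ⊕ Unit → Matrix (Fin n) (Fin n) K =>
        X (Sum.inr ()) i₀ i₀ = funMap f fun i => X (Sum.inl i) i₀ i₀ :=
      ⟨Term.equal (.var (Sum.inr (), i₀, i₀))
        (.func (Sum.inr f : (fieldLang L).Functions k) fun i => .var (Sum.inl i, i₀, i₀)),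
        fun X => by rw [Formula.realize_equal]; rfl⟩
    have hzero : EntryDefinable L fun X : Fin k ⊕ Unit → Matrix (Fin n) (Fin n) K =>
        X (Sum.inr ()) = 0 := (of_matEq (gen (Sum.inr ())) 0).congr fun X => by
      simp only [map_zero, mapMatrix_gen]
    refine ((hcentral.and ((entryDefinable_central i₀ (Sum.inr ())).and hval)).or
      (hcentral.not.and hzero)).congr fun X => ?_
    by_cases hX : ∀ i, X (Sum.inl i) = Matrix.scalar (Fin n) (X (Sum.inl i) i₀ i₀)
    · rw [funMap_newFun_scalar hn f hX]
      constructor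
      · intro h
        have : X (Sum.inr ()) i₀ i₀ = funMap f fun i => X (Sum.inl i) i₀ i₀ := by simp [h]
        exact .inl ⟨hX, by rw [this, ← h], this⟩
      · rintro (⟨-, h1, h2⟩ | ⟨h, -⟩)
        · rw [h1, h2]
        · exact absurd hX h
    · rw [funMap_newFun_of_not f ((exists_scalar_iff i₀ _).not.2 hX)]
      simp only [hX, false_and, not_false_eq_true, true_and, false_or]
  | htr =>
    refine (of_matEq (gen (Sum.inr ())) (Matrix.scalar (Fin n) (gen (Sum.inl 0)).trace)).congr
      fun X => ?_
    have : (FreeCommRing.lift (entryVal X)).mapMatrix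
        (Matrix.scalar (Fin n) (gen (Sum.inl 0)).trace) =
          Matrix.scalar (Fin n) (X (Sum.inl 0)).trace := by
      ext i j
      by_cases h : i = j <;> simp [h, gen, entryVal, Matrix.trace]
    rw [mapMatrix_gen, this, funMap_tr]
  | hinv =>
    refine (of_matEq (gen (Sum.inr ())) (gen (Sum.inl 0))ᵀ).congr fun X => ?_
    have : (FreeCommRing.lift (entryVal X)).mapMatrix (gen (Sum.inl 0))ᵀ = (X (Sum.inl 0))ᵀ :=
      congrArg Matrix.transpose (mapMatrix_gen X (Sum.inl 0))
    rw [mapMatrix_gen, this, funMap_inv]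

theorem entryDefinable_relMap (hn : 0 < n) {k : ℕ} (r : (matLang L).Relations k) :
    EntryDefinable L fun X : Fin k → Matrix (Fin n) (Fin n) K => RelMap r X := by
  have i₀ : Fin n := ⟨0, hn⟩
  induction r using forall_relations with
  | hnew k r =>
    have hval : EntryDefinable L fun X : Fin k → Matrix (Fin n) (Fin n) K =>
        RelMap r fun i => X i i₀ i₀ :=
      ⟨Relations.formula (Sum.inr r : (fieldLang L).Relations k) fun i => .var (i, i₀, i₀),
        fun X => Iff.rfl⟩
    refine ((forall_finite fun i => entryDefinable_central i₀ i).and hval).congr fun X => ?_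
    by_cases hX : ∀ i, X i = Matrix.scalar (Fin n) (X i i₀ i₀)
    · rw [relMap_newRel_scalar hn r hX]
      exact (and_iff_right hX).symm
    · rw [relMap_newRel]
      exact ⟨fun ⟨a, ha, _⟩ => absurd ((exists_scalar_iff i₀ X).1 ⟨a, ha⟩) hX,
        fun h => absurd h.1 hX⟩

/-- Since only graphs are definable, composition quantifies over the intermediate values. -/
theorem entryDefinable_term (hn : 0 < n) (t : (matLang L).Term α) :
    EntryDefinable L fun X : α ⊕ Unit → Matrix (Fin n) (Fin n) K =>
      X (Sum.inr ()) = t.realize fun a => X (Sum.inl a) := by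
  induction t with
  | var a =>
    refine (of_matEq (gen (Sum.inr ())) (gen (Sum.inl a))).congr fun X => ?_
    rw [mapMatrix_gen, mapMatrix_gen]
    rfl
  | @func k f ts ih =>
    have h1 : EntryDefinable L fun X : (α ⊕ Unit) ⊕ Fin k → Matrix (Fin n) (Fin n) K =>
        ∀ i, X (Sum.inr i) = (ts i).realize fun a => X (Sum.inl (Sum.inl a)) :=
      forall_finite fun i =>
        (ih i).relabel (Sum.elim (fun a => Sum.inl (Sum.inl a)) fun _ => Sum.inr i)
    have h2 : EntryDefinable L fun X : (α ⊕ Unit) ⊕ Fin k → Matrix (Fin n) (Fin n) K =>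
        X (Sum.inl (Sum.inr ())) = funMap f fun i => X (Sum.inr i) :=
      (entryDefinable_funMap hn f).relabel (Sum.elim Sum.inr fun _ => Sum.inl (Sum.inr ()))
    refine (h1.and h2).exists_family.congr fun X => ?_
    simp only [Sum.elim_inl, Sum.elim_inr, Term.realize]
    refine ⟨fun h => ⟨_, fun i => rfl, h⟩, ?_⟩
    rintro ⟨W, hW, h⟩
    rw [h, funext hW]

theorem entryDefinable_boundedFormula (hn : 0 < n) {m : ℕ} (φ : (matLang L).BoundedFormula α m) :
    EntryDefinable L fun X : α ⊕ Fin m → Matrix (Fin n) (Fin n) K =>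
      φ.Realize (fun a => X (Sum.inl a)) fun i => X (Sum.inr i) := by
  have hsum : ∀ {m : ℕ} (X : α ⊕ Fin m → Matrix (Fin n) (Fin n) K),
      Sum.elim (fun a => X (Sum.inl a)) (fun i => X (Sum.inr i)) = X :=
    fun X => Sum.elim_comp_inl_inr X
  induction φ with
  | falsum => exact of_false
  | equal t₁ t₂ =>
    refine ((entryDefinable_term hn t₁).and (entryDefinable_term hn t₂)).exists_family.congr
      fun X => ?_
    simp only [BoundedFormula.Realize, hsum, Sum.elim_inl, Sum.elim_inr]
    exact ⟨fun h => ⟨fun _ => t₁.realize X, rfl, h⟩, fun ⟨W, h1, h2⟩ => h1.symm.trans h2⟩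
  | @rel m k r ts =>
    have h1 : EntryDefinable L fun X : (α ⊕ Fin m) ⊕ Fin k → Matrix (Fin n) (Fin n) K =>
        ∀ i, X (Sum.inr i) = (ts i).realize fun a => X (Sum.inl a) :=
      forall_finite fun i =>
        (entryDefinable_term hn (ts i)).relabel (Sum.elim Sum.inl fun _ => Sum.inr i)
    have h2 : EntryDefinable L fun X : (α ⊕ Fin m) ⊕ Fin k → Matrix (Fin n) (Fin n) K =>
        RelMap r fun i => X (Sum.inr i) := (entryDefinable_relMap hn r).relabel Sum.inr
    refine (h1.and h2).exists_family.congr fun X => ?_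
    simp only [BoundedFormula.Realize, hsum, Sum.elim_inl, Sum.elim_inr]
    refine ⟨fun h => ⟨_, fun i => rfl, h⟩, ?_⟩
    rintro ⟨W, hW, h⟩
    rwa [funext hW] at h
  | imp _ _ ih₁ ih₂ => exact ih₁.imp ih₂
  | @all m φ ih =>
    refine (ih.relabel (Sum.elim (fun a => Sum.inl (Sum.inl a))
      (Fin.snoc (α := fun _ => (α ⊕ Fin m) ⊕ Unit) (fun i => Sum.inl (Sum.inr i))
        (Sum.inr ())))).forall_family.congr fun X => ?_
    have hsnoc : ∀ W : Unit → Matrix (Fin n) (Fin n) K,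
        (fun i : Fin (m + 1) => Sum.elim X W (Fin.snoc (α := fun _ => (α ⊕ Fin m) ⊕ Unit)
          (fun i => Sum.inl (Sum.inr i)) (Sum.inr ()) i)) =
        Fin.snoc (α := fun _ => Matrix (Fin n) (Fin n) K) (fun i => X (Sum.inr i)) (W ()) := by
      intro W
      ext1 i
      refine Fin.lastCases ?_ (fun i => ?_) i <;> simp
    simp only [Sum.elim_inl, Sum.elim_inr, hsnoc, BoundedFormula.realize_all]
    exact ⟨fun h W => h (W ()), fun h Z => h fun _ => Z⟩

/-! ### The Specht property implies quantifier elimination -/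

/-- Conjugation by an orthogonal matrix is an automorphism of the matrix structure. -/
theorem realize_iff_of_conj (hn : 0 < n) (φ : (matLang L).Formula α)
    {X Y : α → Matrix (Fin n) (Fin n) K} {O : Matrix (Fin n) (Fin n) K} (hO : O * Oᵀ = 1)
    (hXY : ∀ i, Oᵀ * X i * O = Y i) : φ.Realize X ↔ φ.Realize Y := by
  obtain ⟨g, hg⟩ := exists_embedding_of_conj hn (Embedding.refl (fieldLang L) K) O hO
  have hg' : ∀ A, g A = Oᵀ * A * O := fun A => (hg A).trans (by congr 2)
  have hsurj : Function.Surjective g := fun B => ⟨O * B * Oᵀ, by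
    have hO' : Oᵀ * O = 1 := mul_eq_one_comm.mp hO
    rw [hg']
    simp only [← Matrix.mul_assoc, hO', Matrix.one_mul]
    rw [Matrix.mul_assoc, hO', Matrix.mul_one]⟩
  let e : Matrix (Fin n) (Fin n) K ≃[matLang L] Matrix (Fin n) (Fin n) K :=
    { toEquiv := Equiv.ofBijective g ⟨g.injective, hsurj⟩
      map_fun' := g.map_fun
      map_rel' := g.map_rel }
  have : Y = e ∘ X := funext fun i => (hXY i).symm.trans (hg' _).symm
  rw [this]
  exact (StrongHomClass.realize_formula e φ).symm

theorem hasQE_of_spechtProperty {F : Type u} [Field F] [CompatibleRing F] [L.Structure F]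
    (hQE : HasQE (fieldLang L) F) (hn : 0 < n) (h : SpechtProperty F n) :
    HasQE (matLang L) (Matrix (Fin n) (Fin n) F) := by
  intro k φ
  obtain ⟨D, hD⟩ := h
  obtain ⟨φ', hφ'⟩ := (entryDefinable_boundedFormula (K := F) hn φ).relabel
    (Sum.elim id Fin.elim0)
  replace hφ' : ∀ X : Fin k → Matrix (Fin n) (Fin n) F,
      φ.Realize X ↔ φ'.Realize (entryVal X) := fun X => by
    rw [← hφ', Formula.Realize]
    exact iff_of_eq (congrArg _ (Subsingleton.elim _ _))
  let W := {w : List (Fin k × Bool) // w.length ≤ D}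
  let tr : W → (fieldLang L).Term (Fin k × Fin n × Fin n) := fun w =>
    (LHom.sumInl : Language.ring →ᴸ fieldLang L).onTerm
      (termOfFreeCommRing (ringWordEval gen w.1).trace)
  have htr : ∀ w (X : Fin k → Matrix (Fin n) (Fin n) F),
      (tr w).realize (entryVal X) = (wordEval X w.1).trace := by
    intro w X
    rw [LHom.realize_onTerm, realize_termOfFreeCommRing]
    exact map_trace_ringWordEval X id w.1
  -- `θ` defines the set of trace vectors of the realizations of `φ`; its variables are the finitely
  -- many words of length at most `D`.
  let θ : (fieldLang L).Formula W := Formula.iExs (Fin k × Fin n × Fin n) <|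
    φ'.relabel Sum.inr ⊓
      Formula.iInf fun w : W => ((tr w).relabel Sum.inr).equal (.var (Sum.inl w))
  have hθ : ∀ t : W → F, θ.Realize t ↔
      ∃ Y : Fin k → Matrix (Fin n) (Fin n) F, φ.Realize Y ∧
        ∀ w : W, (wordEval Y w.1).trace = t w := by
    intro t
    rw [Formula.realize_iExs]
    have : ∀ Y : Fin k → Matrix (Fin n) (Fin n) F,
        (φ'.relabel Sum.inr ⊓ Formula.iInf fun w : W =>
          ((tr w).relabel Sum.inr).equal (.var (Sum.inl w))).Realize
            (fun a => Sum.elim t (entryVal Y) a) ↔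
          φ.Realize Y ∧ ∀ w : W, (wordEval Y w.1).trace = t w := by
      intro Y
      rw [Formula.realize_inf, Formula.realize_iInf, Formula.realize_relabel]
      refine and_congr (hφ' Y).symm (forall_congr' fun w => ?_)
      rw [Formula.realize_equal, Term.realize_relabel, ← htr]
      rfl
    exact ⟨fun ⟨v, hv⟩ => ⟨ofEntryVal v, (this _).1 hv⟩,
      fun ⟨Y, hY⟩ => ⟨entryVal Y, (this _).2 hY⟩⟩
  obtain ⟨θ', hθ'QF, hθ'⟩ := hQE.exists_isQF θ
  -- The variable of each word is replaced by the term for its trace. These terms take central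
  -- values, where `θ'` has the meaning it has in `F`.
  refine ⟨BoundedFormula.subst (ofField.onFormula θ') fun w => trTerm (wordTerm w.1),
    isQF_subst (isQF_onBoundedFormula _ hθ'QF) _, fun X => ?_⟩
  have h1 : Formula.Realize (BoundedFormula.subst (ofField.onFormula θ')
      fun w => trTerm (wordTerm w.1)) X ↔
        θ'.Realize fun w : W => (wordEval X w.1).trace := by
    rw [Formula.Realize, BoundedFormula.realize_subst, ← realize_onFormula_scalar hn hθ'QF]
    simp only [realize_trTerm, realize_wordTerm]
    rfl
  rw [h1, ← hθ', hθ]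
  refine ⟨fun hX => ⟨X, hX, fun _ => rfl⟩, ?_⟩
  rintro ⟨Y, hY, htraces⟩
  -- Some realization `Y` has the traces of `X`; by Specht it is conjugate to `X`, so `X` realizes
  -- `φ` too.
  obtain ⟨O, hO, hconj⟩ := hD k Y X fun w hw => htraces ⟨w, hw⟩
  exact (realize_iff_of_conj hn φ hO hconj).1 hY

end MatLang

theorem mainTheorem1 {F : Type u} [Field F] [CompatibleRing F] [IsSemireal F]
    (hF : IsPythagorean F) (L : FirstOrder.Language.{v, w}) [L.Structure F]
    (hQE : HasQE (fieldLang L) F) (n : ℕ) (hn : 0 < n) :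
    List.TFAE [
      HasQE (matLang L) (Matrix (Fin n) (Fin n) F),
      SpechtProperty F n,
      EmbeddingsExtend.{u, v, w, x} L F n] := by
  have hF' := hF.isRealPythagorean
  tfae_have 1 → 2 := MatLang.spechtProperty_of_hasQE hF' hn
  tfae_have 2 → 1 := MatLang.hasQE_of_spechtProperty hQE hn
  tfae_have 2 → 3 := MatLang.embeddingsExtend_of_spechtProperty hF' hQE hn
  tfae_have 3 → 2 := MatLang.spechtProperty_of_embeddingsExtend hF' hn
  tfae_finish
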